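/- Let $S^1=\mathbb R/\mathbb Z$ and let $\mathcal M=\mathrm{Exp}_2(S^1)=\{\{s,t\}: s,t\in S^1\}$ be the quotient of $S^1\times S^1$ by the swap of the factors. This is a Möbius band, a smooth compact manifold with boundary $\partial\mathcal M=\{\{s\}:s\in S^1\}$, whose charts are the local inverses of the universal covering $\{(x,y)\in\mathbb R^2: 0\le y-x\le 1\}\to\mathcal M$, $(x,y)\mapsto\{x+\mathbb Z,\,y+\mathbb Z\}$. Let $g:\mathcal M\to[0,\infty)$ be a $C^2$ function (up to the boundary) with $g^{-1}(0)=\partial\mathcal M$ that is Morse-supported, i.e. every critical point of $g$ in the interior of $\mathcal M$ is nondegenerate, there are only finitely many of them, and there is $a>0$ such that for every $t\in[0,a]$ the boundary $\partial\mathcal M$ is a deformation retract of the sublevel set $g^{-1}[0,t]$. Let $p$ be a prime, and let $\mathrm{PH}_1(g;\mathbb Z_p)$ be the persistence diagram of the persistence module $t\mapsto H_1(\{g\le t\};\mathbb Z_p)$, $t\in\mathbb R$ (singular homology, with the maps induced by inclusions). This module is q-tame, and its diagram is the multiset of points $(b,d)$ with $-\infty\le b<d\le\infty$, finite on rectangles,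 that is determined by the condition that for all $-\infty\le a<b<c<d\le\infty$ and $R=[a,b]\times[c,d]$, $$\#(\mathrm{PH}_1\cap R^\circ)\ \le\ r_b^c-r_a^c-r_b^d+r_a^d\ \le\ \#(\mathrm{PH}_1\cap R),$$ where $r_s^t$ is the rank of $H_1(\{g\le s\};\mathbb Z_p)\to H_1(\{g\le t\};\mathbb Z_p)$, taken to be $0$ if $s=-\infty$ or $t=\infty$, and where $R^\circ$ is the interior of $R$ in the extended plane $[-\infty,\infty]^2$. Then there is a real number $$l\ \le\ \min_{s\in S^1}\max_{t\in S^1} g(\{s,t\})$$ such that: * if $p=2$, then $(0,\max g)$ and $(l,\infty)$ are points of $\mathrm{PH}_1(g;\mathbb Z_p)$; * if $p\neq 2$, then $(0,\infty)$ and $(l,\max g)$ are points of $\mathrm{PH}_1(g;\mathbb Z_p)$. -/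

import Mathlib

open CategoryTheory Topology

/-! ### The two-point finite subset space of the circle (the Möbius band) -/

/-- The two-point finite subset space of the circle `S¹ = ℝ / ℤ`: the space of subsets `{s, t}` of
`S¹` with one or two elements, that is the quotient of `S¹ × S¹` by the swap of the factors.
It carries the quotient topology, and it is a Möbius band. -/
abbrev ExpTwoCircle : Type := Sym2 UnitAddCircle

/-- The quotient topology induced by `S¹ × S¹ → Exp₂(S¹)`. -/
instance ExpTwoCircle.instTopologicalSpace : TopologicalSpace ExpTwoCircle :=
  TopologicalSpace.coinduced
    (fun z : UnitAddCircle × UnitAddCircle => (s(z.1, z.2) : ExpTwoCircle)) inferInstance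

namespace ExpTwoCircle

/-- The composite `ℝ² → S¹ × S¹ → Exp₂(S¹)`. -/
def proj (z : ℝ × ℝ) : ExpTwoCircle :=
  s((z.1 : UnitAddCircle), (z.2 : UnitAddCircle))

/-- The closed strip `0 ≤ y - x ≤ 1`. The map `proj` restricts to the universal covering of the
Möbius band by this strip; its local inverses are the charts that make `Exp₂(S¹)` a smooth manifold
with boundary (the transition maps are restrictions of powers of `(x, y) ↦ (y, x + 1)`). -/
def strip : Set (ℝ × ℝ) := {z | z.1 ≤ z.2 ∧ z.2 ≤ z.1 + 1}

/-- The open strip `0 < y - x < 1`, which covers the interior of the Möbius band. -/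
def openStrip : Set (ℝ × ℝ) := {z | z.1 < z.2 ∧ z.2 < z.1 + 1}

/-- The boundary circle of the Möbius band: the one-element subsets of `S¹`. -/
def boundary : Set ExpTwoCircle := {w | w.IsDiag}

/-- `g` is a `Cᵏ` function on the Möbius band as a manifold with boundary: its expression in the
charts, which are the local inverses of `proj` on the closed strip, is `Cᵏ` up to the boundary. -/
def IsContDiff (k : WithTop ℕ∞) (g : ExpTwoCircle → ℝ) : Prop :=
  ContDiffOn ℝ k (g ∘ proj) strip

/-- `z` is the coordinate of an interior critical point of `g`. -/
def IsInteriorCriticalCoord (g : ExpTwoCircle → ℝ) (z : ℝ × ℝ) : Prop :=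
  z ∈ openStrip ∧ fderiv ℝ (g ∘ proj) z = 0

/-- The Hessian of `g` in the coordinate `z` is a nondegenerate bilinear form. -/
def HasNondegenerateHessian (g : ExpTwoCircle → ℝ) (z : ℝ × ℝ) : Prop :=
  ∀ v : ℝ × ℝ, (∀ w : ℝ × ℝ, fderiv ℝ (fderiv ℝ (g ∘ proj)) z v w = 0) → v = 0

end ExpTwoCircle

/-- `A` is a deformation retract of `S`: there is a homotopy from the identity of `S` to a
retraction of `S` onto `A`. (The points of `A` are not required to stay fixed at intermediate
times; as a hypothesis, this is the weaker of the two usual definitions.) -/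
def IsDeformationRetract {X : Type*} [TopologicalSpace X] (A S : Set X) : Prop :=
  A ⊆ S ∧ ∃ H : unitInterval × S → S, Continuous H ∧ (∀ x, H (0, x) = x) ∧
    (∀ x, (H (1, x) : X) ∈ A) ∧ ∀ x : S, (x : X) ∈ A → H (1, x) = x

/-- Morse-supported functions on the Möbius band `Exp₂(S¹)`. -/
structure IsMorseSupported (g : ExpTwoCircle → ℝ) : Prop where
  contDiff : ExpTwoCircle.IsContDiff 2 g
  nonneg : ∀ w, 0 ≤ g w
  zero_iff : ∀ w, g w = 0 ↔ w ∈ ExpTwoCircle.boundary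
  /-- All interior critical points are nondegenerate. -/
  nondegenerate : ∀ z, ExpTwoCircle.IsInteriorCriticalCoord g z →
    ExpTwoCircle.HasNondegenerateHessian g z
  /-- There are finitely many interior critical points. -/
  finite_critical : (ExpTwoCircle.proj '' {z | ExpTwoCircle.IsInteriorCriticalCoord g z}).Finite
  /-- The boundary is a deformation retract of all sufficiently low sublevel sets. -/
  retract : ∃ a : ℝ, 0 < a ∧ ∀ t ∈ Set.Icc 0 a,
    IsDeformationRetract ExpTwoCircle.boundary {w | g w ≤ t}

/-! ### Persistence modules and their diagrams -/

/-- A persistence module over `ℝ` with coefficients in `F`. -/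
abbrev PersistenceModule (F : Type) [Field F] := ℝ ⥤ ModuleCat.{0} F

/-- The filtration of a space by the sublevel sets `{x | f x ≤ t}` and their inclusions. -/
def sublevelFiltration {X : Type} [TopologicalSpace X] (f : X → ℝ) : ℝ ⥤ TopCat.{0} where
  obj t := TopCat.of {x : X // f x ≤ t}
  map {s t} h := TopCat.ofHom
    ⟨fun x => ⟨x.1, x.2.trans (leOfHom h)⟩, by fun_prop⟩

/-- The `n`-th persistent (singular) homology of the sublevel set filtration of `f`. -/
noncomputable def sublevelHomology (F : Type) [Field F] (n : ℕ) {X : Type} [TopologicalSpace X]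
    (f : X → ℝ) : PersistenceModule F :=
  sublevelFiltration f ⋙
    (AlgebraicTopology.singularHomologyFunctor (ModuleCat.{0} F) n).obj (ModuleCat.of F F)

namespace PersistenceModule

variable {F : Type} [Field F]

/-- `V` is q-tame: the map `V s ⟶ V t` has finite rank for all `s < t`. -/
def IsQTame (V : PersistenceModule F) : Prop :=
  ∀ (s t : ℝ) (h : s < t),
    FiniteDimensional F (LinearMap.range (V.map (homOfLE h.le)).hom)

open Classical in
/-- The rank of the map `V s ⟶ V t` for extended real `s < t`, where `V (-∞) = V (+∞) = 0`. -/
noncomputable def rank (V : PersistenceModule F) (s t : EReal) : ℕ :=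
  if h : s ≠ ⊥ ∧ t ≠ ⊤ ∧ s.toReal ≤ t.toReal then
    Module.finrank F (LinearMap.range (V.map (homOfLE h.2.2)).hom)
  else 0

/-- The persistence measure of the rectangle `[a, b] × [c, d]`. -/
noncomputable def measure (V : PersistenceModule F) (a b c d : EReal) : ℤ :=
  V.rank b c - V.rank a c - V.rank b d + V.rank a d

/-- The function `D`, which assigns to a point of the extended plane its multiplicity, is a
persistence diagram of the q-tame persistence module `V`: it is a multiset of points of the extended
half-plane `{(s, t) | -∞ ≤ s < t ≤ ∞}` which is finite on each rectangle `R = [a, b] × [c, d]` with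
`-∞ ≤ a < b < c < d ≤ ∞`, and whose number of points in `R` is the persistence measure of `R`.
As usual, a point on the edge of `R` (relative to the extended plane) may or may not be counted by
the measure, depending on whether the end points belong to the corresponding interval. -/
structure IsDiagram (V : PersistenceModule F) (D : EReal × EReal → ℕ) : Prop where
  qtame : V.IsQTame
  lt_of_ne_zero : ∀ z, D z ≠ 0 → z.1 < z.2
  finite : ∀ a b c d : EReal, a < b → b < c → c < d →
    (Function.support D ∩ Set.Icc a b ×ˢ Set.Icc c d).Finite
  card_interior_le : ∀ a b c d : EReal, a < b → b < c → c < d →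
    ((∑ᶠ z ∈ interior (Set.Icc a b ×ˢ Set.Icc c d), D z : ℕ) : ℤ) ≤ V.measure a b c d
  le_card : ∀ a b c d : EReal, a < b → b < c → c < d →
    V.measure a b c d ≤ ((∑ᶠ z ∈ Set.Icc a b ×ˢ Set.Icc c d, D z : ℕ) : ℤ)

/-- There is at most one persistence diagram. -/
theorem IsDiagram.unique {V : PersistenceModule F} {D E : EReal × EReal → ℕ}
    (hD : V.IsDiagram D) (hE : V.IsDiagram E) : D = E := by
  have key : ∀ {D E : EReal × EReal → ℕ}, V.IsDiagram D → V.IsDiagram E →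
      ∀ z, D z ≤ E z := by
    intro D E hD hE z
    obtain ⟨x, y⟩ := z
    by_cases hxy : x < y
    swap
    · have : D (x, y) = 0 := by
        by_contra h
        exact hxy (hD.lt_of_ne_zero _ h)
      omega
    -- small closed intervals around a point of the extended line
    have small : ∀ (x : EReal) (U : Set EReal), U ∈ 𝓝 x →
        ∃ a b, a < b ∧ Set.Icc a b ∈ 𝓝 x ∧ Set.Icc a b ⊆ U := by
      intro x U hU
      obtain ⟨a, b, hm, hn, hs⟩ := exists_Icc_mem_subset_of_mem_nhds hU
      refine ⟨a, b, lt_of_le_of_ne (hm.1.trans hm.2) ?_, hn, hs⟩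
      rintro rfl
      obtain rfl : x = a := le_antisymm hm.2 hm.1
      rw [Set.Icc_self] at hn
      have : (⊥ : EReal) < ⊤ := bot_lt_top
      have hc : IsClopen ({x} : Set EReal) := ⟨isClosed_singleton, by
        rw [isOpen_iff_mem_nhds]; rintro _ rfl; exact hn⟩
      rcases isClopen_iff.1 hc with h | h
      · simp at h
      · have h1 : (⊥ : EReal) ∈ ({x} : Set EReal) := h ▸ Set.mem_univ _
        have h2 : (⊤ : EReal) ∈ ({x} : Set EReal) := h ▸ Set.mem_univ _
        rw [Set.mem_singleton_iff] at h1 h2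
        exact this.ne (h1.trans h2.symm)
    obtain ⟨m, hxm, hmy⟩ := exists_between hxy
    obtain ⟨a, b, hab, hnx, hsx⟩ := small x _ (Iio_mem_nhds hxm)
    obtain ⟨c, d, hcd, hny, hsy⟩ := small y _ (Ioi_mem_nhds hmy)
    have hbc : b < c := (hsx ⟨hab.le, le_rfl⟩ : b < m).trans (hsy ⟨le_rfl, hcd.le⟩ : m < c)
    -- remove the finitely many other points of `E`
    have hfin : ((Function.support E ∩ Set.Icc a b ×ˢ Set.Icc c d) \ {(x, y)}).Finite :=
      (hE.finite a b c d hab hbc hcd).sdiff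
    have hU : ((Function.support E ∩ Set.Icc a b ×ˢ Set.Icc c d) \ {(x, y)})ᶜ ∈ 𝓝 (x, y) :=
      hfin.isClosed.isOpen_compl.mem_nhds (by simp)
    rw [nhds_prod_eq, Filter.mem_prod_iff] at hU
    obtain ⟨A, hA, B, hB, hAB⟩ := hU
    obtain ⟨a', b', hab', hnx', hsx'⟩ := small x _ (Filter.inter_mem hA hnx)
    obtain ⟨c', d', hcd', hny', hsy'⟩ := small y _ (Filter.inter_mem hB hny)
    have hbc' : b' < c' :=
      ((hsx' ⟨hab'.le, le_rfl⟩).2.2.trans_lt hbc).trans_le (hsy' ⟨le_rfl, hcd'.le⟩).2.1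
    have hint : (x, y) ∈ interior (Set.Icc a' b' ×ˢ Set.Icc c' d') := by
      rw [mem_interior_iff_mem_nhds, nhds_prod_eq]
      exact Filter.prod_mem_prod hnx' hny'
    have h1 := hD.card_interior_le a' b' c' d' hab' hbc' hcd'
    have h2 := hE.le_card a' b' c' d' hab' hbc' hcd'
    have h3 : D (x, y) ≤
        ∑ᶠ z ∈ interior (Set.Icc a' b' ×ˢ Set.Icc c' d'), D z := by
      have hf : (interior (Set.Icc a' b' ×ˢ Set.Icc c' d') ∩ Function.support D).Finite :=
        (hD.finite a' b' c' d' hab' hbc' hcd').subset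
          fun z hz => ⟨hz.2, interior_subset hz.1⟩
      by_cases h0 : D (x, y) = 0
      · omega
      rw [finsum_mem_eq_sum _ hf]
      exact Finset.single_le_sum (f := D) (fun _ _ => Nat.zero_le _)
        (hf.mem_toFinset.2 ⟨hint, h0⟩)
    have h4 : ∑ᶠ z ∈ Set.Icc a' b' ×ˢ Set.Icc c' d', E z ≤ E (x, y) := by
      have hf : (Set.Icc a' b' ×ˢ Set.Icc c' d' ∩ Function.support E).Finite :=
        (hE.finite a' b' c' d' hab' hbc' hcd').subset fun z hz => ⟨hz.2, hz.1⟩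
      rw [finsum_mem_eq_sum _ hf]
      calc _ ≤ ∑ z ∈ ({(x, y)} : Finset (EReal × EReal)), E z := by
            refine Finset.sum_le_sum_of_subset ?_
            intro z hz
            obtain ⟨hz1, hz2⟩ := hf.mem_toFinset.1 hz
            by_contra hne
            have hm : z ∈ A ×ˢ B := ⟨(hsx' hz1.1).1, (hsy' hz1.2).1⟩
            exact hAB hm ⟨⟨hz2, (hsx' hz1.1).2, (hsy' hz1.2).2⟩, by simpa using hne⟩
        _ = E (x, y) := by simp
    omega
  funext z
  exact le_antisymm (key hD hE z) (key hE hD z)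

open Classical in
/-- The persistence diagram of a q-tame persistence module, as the function that assigns to each
point its multiplicity (and the zero function if there is no diagram). -/
noncomputable def diagram (V : PersistenceModule F) : EReal × EReal → ℕ :=
  if h : ∃ D, V.IsDiagram D then h.choose else 0

end PersistenceModule

/-- The set of points of `PH_n(f; F)`, the persistence diagram of the `n`-th singular homology with
coefficients in `F` of the sublevel set filtration of `f`. -/
def persistencePoints (F : Type) [Field F] (n : ℕ) {X : Type} [TopologicalSpace X]
    (f : X → ℝ) : Set (EReal × EReal) :=
  Function.support (sublevelHomology F n f).diagram

/-! ### First homology of a chain complex of vector spaces, in terms of elements -/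

/-! No homology group is computed. Classes are written down on explicit curves, and explicit
cocycles show that they survive. The curves are the boundary curve `diagCurve` and, for each s in
the circle, the curve `fiberCurve s` of all sets containing s, a core of the band. The triangle with
vertices (s, s), (s, s+1), (s+1, s+1) projects to a 2-simplex which shows that the boundary is
homologous to twice the core (`two_smul_seg_sub_seg_mem_boundaries`).

Two winding numbers serve as cocycles. That of the sum of the two elements is 2 on the boundary and
1 on the core (`exists_winding_sum`), so the core never dies, and neither does the boundary if 2 ≠
0. That around an interior point w₀ is 1 on the boundary and 0 on a core avoiding w₀
(`exists_winding_slit`). Taking for w₀ a maximum point of g, it detects classes in every sublevel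
set strictly below the maximum.

If p = 2, the boundary class is born at 0, survives below the maximum and dies there: a low sublevel
set deforms onto the boundary, which is null-homologous in the band. The infimum of the levels that
carry a class surviving to the maximum gives (l, ∞). If p is odd, the boundary class gives (0, ∞).
Twice a core minus the boundary dies at the maximum but has winding number -1 around w₀, so it is
nonzero below. The infimum of the levels carrying such classes gives (l, max g). Finitely many
critical points imply that some core avoids all maxima, so that this infimum is below the maximum.
In both cases a core lives in the sublevel set at the maximum of g on it, which bounds l by the
min-max value.

Ranks are turned into points by `IsDiagram.ne_zero_of_finite` and `IsDiagram.ne_zero_of_top`. This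
needs a diagram to exist, which holds for every q-tame module (`IsQTame.isDiagram_multiplicity`).
Here q-tameness comes from compactness of the sublevel sets and local contractibility of the band
(`isQTame_sublevelHomology`). -/

namespace ChainComplex

variable {F : Type} [Field F] (K L : ChainComplex (ModuleCat.{0} F) ℕ)

/-- The homology class of a 1-cycle. -/
noncomputable def homologyClassOne : LinearMap.ker (K.d 1 0).hom →ₗ[F] K.homology 1 :=
  (K.liftCycles (ModuleCat.ofHom (LinearMap.ker (K.d 1 0).hom).subtype) 0 (by simp)
    (by ext x; exact x.2) ≫ K.homologyπ 1).hom

theorem homologyClassOne_surjective : Function.Surjective K.homologyClassOne := by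
  intro h
  obtain ⟨c, rfl⟩ := (ModuleCat.epi_iff_surjective (K.homologyπ 1)).1 inferInstance h
  have hc : (K.d 1 0).hom ((K.iCycles 1).hom c) = 0 := by
    rw [← ModuleCat.comp_apply, HomologicalComplex.iCycles_d]; rfl
  refine ⟨⟨(K.iCycles 1).hom c, hc⟩, ?_⟩
  rw [homologyClassOne, ModuleCat.comp_apply]
  congr 1
  apply (ModuleCat.mono_iff_injective (K.iCycles 1)).1 inferInstance
  rw [← ModuleCat.comp_apply, HomologicalComplex.liftCycles_i]
  rfl

/-- Homology is the cokernel of the map from 2-chains to cycles, and cycles embed into 1-chains. -/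
theorem homologyClassOne_eq_zero_iff (z : LinearMap.ker (K.d 1 0).hom) :
    K.homologyClassOne z = 0 ↔ (z : K.X 1) ∈ LinearMap.range (K.d 2 1).hom := by
  have hi : ∀ z : LinearMap.ker (K.d 1 0).hom, (K.iCycles 1).hom
      ((K.liftCycles (ModuleCat.ofHom (LinearMap.ker (K.d 1 0).hom).subtype) 0 (by simp)
        (by ext x; exact x.2)).hom z) = z := by
    intro z
    rw [← ModuleCat.comp_apply, HomologicalComplex.liftCycles_i]
    rfl
  have hex : (ShortComplex.mk (K.toCycles 2 1) (K.homologyπ 1) (by simp)).Exact :=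
    ShortComplex.exact_of_g_is_cokernel _ (K.homologyIsCokernel 2 1 (by simp))
  rw [ShortComplex.moduleCat_exact_iff] at hex
  constructor
  · intro h
    rw [homologyClassOne, ModuleCat.comp_apply] at h
    obtain ⟨x, hx⟩ := hex _ h
    refine ⟨x, ?_⟩
    rw [← hi z, ← K.toCycles_i 2 1, ModuleCat.comp_apply]
    exact congrArg _ hx
  · rintro ⟨x, hx⟩
    rw [homologyClassOne, ModuleCat.comp_apply]
    have : (K.liftCycles (ModuleCat.ofHom (LinearMap.ker (K.d 1 0).hom).subtype) 0 (by simp)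
        (by ext x; exact x.2)).hom z = (K.toCycles 2 1).hom x := by
      apply (ModuleCat.mono_iff_injective (K.iCycles 1)).1 inferInstance
      rw [hi, ← ModuleCat.comp_apply, K.toCycles_i, ← hx]
    rw [this, ← ModuleCat.comp_apply, HomologicalComplex.toCycles_comp_homologyπ]
    rfl

variable {K L}

theorem homologyMap_homologyClassOne (φ : K ⟶ L) (z : LinearMap.ker (K.d 1 0).hom)
    (w : LinearMap.ker (L.d 1 0).hom) (h : (φ.f 1).hom z = w) :
    (HomologicalComplex.homologyMap φ 1).hom (K.homologyClassOne z) = L.homologyClassOne w := by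
  rw [homologyClassOne, homologyClassOne, ModuleCat.comp_apply, ModuleCat.comp_apply,
    ← ModuleCat.comp_apply, HomologicalComplex.homologyπ_naturality, ModuleCat.comp_apply]
  congr 1
  apply (ModuleCat.mono_iff_injective (L.iCycles 1)).1 inferInstance
  rw [← ModuleCat.comp_apply, HomologicalComplex.cyclesMap_i, ← ModuleCat.comp_apply,
    ← ModuleCat.comp_apply, HomologicalComplex.liftCycles_i, ← Category.assoc,
    HomologicalComplex.liftCycles_i]
  exact h

end ChainComplex

/-! ### Singular chains in low degrees -/

namespace SingularChain

open Simplicial AlgebraicTopology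

variable (F : Type) [Field F] (X : Type) [TopologicalSpace X]
  (Y : Type) [TopologicalSpace Y]

/-- The singular chain complex with coefficients in `F`. -/
noncomputable abbrev cpx : ChainComplex (ModuleCat.{0} F) ℕ :=
  (TopCat.toSSet.obj (TopCat.of X)).chainComplex (ModuleCat.of F F)

variable {X Y}

/-- The chain of a singular simplex. -/
noncomputable def single {n : ℕ} (σ : C(stdSimplex ℝ (Fin (n + 1)), X)) : (cpx F X).X n :=
  ((TopCat.toSSet.obj (TopCat.of X)).ιChainComplex (R := ModuleCat.of F F)
    ((TopCat.toSSetObjEquiv (TopCat.of X) (.op ⦋n⦌)).symm σ)).hom (1 : F)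

/-- The chain map induced by a continuous map. -/
noncomputable abbrev cpxMap (f : C(X, Y)) : cpx F X ⟶ cpx F Y :=
  SSet.chainComplexMap (TopCat.toSSet.map (TopCat.ofHom f)) (ModuleCat.of F F)

/-- The map on chains induced by a continuous map. -/
noncomputable def push (n : ℕ) (f : C(X, Y)) : (cpx F X).X n →ₗ[F] (cpx F Y).X n :=
  ((cpxMap F f).f n).hom

/-- The inclusion of a face. -/
noncomputable def face (n : ℕ) (i : Fin (n + 2)) :
    C(stdSimplex ℝ (Fin (n + 1)), stdSimplex ℝ (Fin (n + 2))) :=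
  ⟨stdSimplex.map (Fin.succAbove i), stdSimplex.continuous_map _⟩

theorem push_single {n : ℕ} (f : C(X, Y)) (σ : C(stdSimplex ℝ (Fin (n + 1)), X)) :
    push F n f (single F σ) = single F (f.comp σ) := by
  rw [push, single, ← ModuleCat.comp_apply, SSet.ι_chainComplexMap_f]
  rfl

theorem d_single {n : ℕ} (σ : C(stdSimplex ℝ (Fin (n + 2)), X)) :
    ((cpx F X).d (n + 1) n).hom (single F σ) =
      ∑ i : Fin (n + 2), (-1 : F) ^ i.val • single F (σ.comp (face n i)) := by
  rw [single, ← ModuleCat.comp_apply, SSet.ιChainComplex_d]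
  simp only [ModuleCat.hom_sum, LinearMap.sum_apply]
  refine Finset.sum_congr rfl fun i _ => ?_
  have hz : ∀ (a : (cpx F X).X n) (k : ℕ), ((-1 : ℤ) ^ k) • a = (-1 : F) ^ k • a := by
    intro a k
    rcases Nat.even_or_odd k with h | h <;> simp [h.neg_one_pow]
  rw [← hz]
  rfl

/-- Chains are a coproduct of copies of F indexed by the simplices. This is the uniqueness half of
its universal property; `exists_lift` is the existence half, used to define cochains. -/
theorem hom_ext {n : ℕ} {M : Type} [AddCommGroup M] [Module F M] {φ ψ : (cpx F X).X n →ₗ[F] M}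
    (h : ∀ σ, φ (single F σ) = ψ (single F σ)) : φ = ψ := by
  have : ModuleCat.ofHom φ = ModuleCat.ofHom (Y := M) ψ := by
    apply SSet.chainComplex_hom_ext
    intro x
    ext
    have := h (TopCat.toSSetObjEquiv (TopCat.of X) (.op ⦋n⦌) x)
    simpa [single] using this
  exact congrArg ModuleCat.Hom.hom this

theorem exists_lift {n : ℕ} {M : Type} [AddCommGroup M] [Module F M]
    (w : C(stdSimplex ℝ (Fin (n + 1)), X) → M) :
    ∃ φ : (cpx F X).X n →ₗ[F] M, ∀ σ, φ (single F σ) = w σ := by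
  let c : (cpx F X).X n ⟶ ModuleCat.of F M := Limits.Cofan.IsColimit.desc
    ((TopCat.toSSet.obj (TopCat.of X)).isColimitChainComplexXCofan (ModuleCat.of F F) n)
    (fun x => ModuleCat.ofHom (LinearMap.toSpanSingleton F M
      (w (TopCat.toSSetObjEquiv (TopCat.of X) (.op ⦋n⦌) x))))
  refine ⟨c.hom, fun σ => ?_⟩
  rw [single, ← ModuleCat.comp_apply]
  have := Limits.Cofan.IsColimit.fac
    ((TopCat.toSSet.obj (TopCat.of X)).isColimitChainComplexXCofan (ModuleCat.of F F) n)
    (fun x => ModuleCat.ofHom (LinearMap.toSpanSingleton F M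
      (w (TopCat.toSSetObjEquiv (TopCat.of X) (.op ⦋n⦌) x))))
    ((TopCat.toSSetObjEquiv (TopCat.of X) (.op ⦋n⦌)).symm σ)
  erw [this]
  simp

end SingularChain

/-! ### Calculus of affine segments modulo boundaries -/

namespace SingularChain

variable (F : Type) [Field F] {X : Type} [TopologicalSpace X] {Y : Type} [TopologicalSpace Y]

/-- The singular 1-cycles. -/
noncomputable abbrev Cycles (X : Type) [TopologicalSpace X] : Submodule F ((cpx F X).X 1) :=
  LinearMap.ker ((cpx F X).d 1 0).hom

/-- The singular 1-boundaries. -/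
noncomputable abbrev Boundaries (X : Type) [TopologicalSpace X] : Submodule F ((cpx F X).X 1) :=
  LinearMap.range ((cpx F X).d 2 1).hom

theorem d_push (f : C(X, Y)) (n : ℕ) (x : (cpx F X).X (n + 1)) :
    ((cpx F Y).d (n + 1) n).hom (push F (n + 1) f x) =
      push F n f (((cpx F X).d (n + 1) n).hom x) := by
  rw [push, push, ← ModuleCat.comp_apply, ← ModuleCat.comp_apply, HomologicalComplex.Hom.comm]

theorem push_mem_boundaries (f : C(X, Y)) {z : (cpx F X).X 1} (hz : z ∈ Boundaries F X) :
    push F 1 f z ∈ Boundaries F Y := by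
  obtain ⟨x, rfl⟩ := hz
  exact ⟨push F 2 f x, d_push F f 1 x⟩

theorem push_mem_cycles (f : C(X, Y)) {z : (cpx F X).X 1} (hz : z ∈ Cycles F X) :
    push F 1 f z ∈ Cycles F Y := by
  change ((cpx F Y).d 1 0).hom _ = 0
  rw [d_push, LinearMap.mem_ker.1 hz, map_zero]

variable {E : Type} [AddCommGroup E] [Module ℝ E] [TopologicalSpace E] [ContinuousAdd E]
  [ContinuousSMul ℝ E]

/-- The affine simplex with given vertices. -/
noncomputable def affine {n : ℕ} (v : Fin (n + 1) → E) : C(stdSimplex ℝ (Fin (n + 1)), E) :=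
  ⟨fun p => ∑ i, p.1 i • v i, continuous_finsetSum _ fun i _ =>
    ((continuous_apply i).comp continuous_subtype_val).smul continuous_const⟩

theorem affine_comp_face {n : ℕ} (v : Fin (n + 2) → E) (i : Fin (n + 2)) :
    (affine v).comp (face n i) = affine (v ∘ i.succAbove) := by
  ext p
  change ∑ j, (stdSimplex.map i.succAbove p).1 j • v j = ∑ j, p.1 j • v (i.succAbove j)
  rw [Fin.sum_univ_succAbove _ i]
  have h : ∀ j, (stdSimplex.map i.succAbove p).1 j =
      ∑ k with i.succAbove k = j, p.1 k := fun j => by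
    change (stdSimplex.map i.succAbove p) j = _
    rw [stdSimplex.map_coe, FunOnFinite.linearMap_apply_apply]
    rfl
  simp only [h]
  simp [Fin.succAbove_ne, Finset.filter_eq', (Fin.succAbove_right_injective).eq_iff]

/-- The chain of a point. -/
noncomputable def pt (x : X) : (cpx F X).X 0 := single F (ContinuousMap.const _ x)

/-- The chain of the singular 1-simplex which runs through the image of a segment. -/
noncomputable def seg (ψ : C(E, X)) (a b : E) : (cpx F X).X 1 :=
  single F (ψ.comp (affine ![a, b]))

theorem push_seg (f : C(X, Y)) (ψ : C(E, X)) (a b : E) :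
    push F 1 f (seg F ψ a b) = seg F (f.comp ψ) a b := push_single F f _

theorem d_seg (ψ : C(E, X)) (a b : E) :
    ((cpx F X).d 1 0).hom (seg F ψ a b) = pt F (ψ b) - pt F (ψ a) := by
  have h : ∀ c : E, (affine ![c] : C(stdSimplex ℝ (Fin 1), E)) = ContinuousMap.const _ c := by
    intro c
    ext p
    have := p.2.2
    rw [Fin.sum_univ_one] at this
    simp [affine, this]
  rw [seg, d_single, Fin.sum_univ_two]
  simp only [ContinuousMap.comp_assoc, affine_comp_face]
  have h0 : (![a, b] ∘ (0 : Fin 2).succAbove) = ![b] := by ext i; fin_cases i; rfl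
  have h1 : (![a, b] ∘ (1 : Fin 2).succAbove) = ![a] := by ext i; fin_cases i; rfl
  rw [h0, h1, h, h]
  simp [pt, sub_eq_add_neg]

theorem seg_triangle (ψ : C(E, X)) (a b c : E) :
    seg F ψ a b + seg F ψ b c - seg F ψ a c ∈ Boundaries F X := by
  refine ⟨single F (ψ.comp (affine ![a, b, c])), ?_⟩
  rw [d_single, Fin.sum_univ_three]
  simp only [ContinuousMap.comp_assoc, affine_comp_face]
  have h0 : (![a, b, c] ∘ (0 : Fin 3).succAbove) = ![b, c] := by ext i; fin_cases i <;> rfl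
  have h1 : (![a, b, c] ∘ (1 : Fin 3).succAbove) = ![a, c] := by ext i; fin_cases i <;> rfl
  have h2 : (![a, b, c] ∘ (2 : Fin 3).succAbove) = ![a, b] := by ext i; fin_cases i <;> rfl
  rw [h0, h1, h2]
  simp only [seg]
  simp
  abel

theorem seg_self (ψ : C(E, X)) (a : E) : seg F ψ a a ∈ Boundaries F X := by
  simpa using seg_triangle F ψ a a a

/-- Cut the square along its diagonal from a to d. -/
theorem seg_square (ψ : C(E, X)) (a b c d : E) :
    seg F ψ a b + seg F ψ b d - seg F ψ a c - seg F ψ c d ∈ Boundaries F X := by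
  have := Submodule.sub_mem _ (seg_triangle F ψ a b d) (seg_triangle F ψ a c d)
  convert this using 1
  abel

/-- The chain depends only on the parametrized path. This allows an edge of a square or triangle in
the plane to be identified with a segment of a curve on ℝ. -/
theorem seg_congr {E' : Type} [AddCommGroup E'] [Module ℝ E'] [TopologicalSpace E']
    [ContinuousAdd E'] [ContinuousSMul ℝ E'] {ψ : C(E, X)} {ψ' : C(E', X)} {a b : E} {a' b' : E'}
    (h : ∀ t ∈ Set.Icc (0 : ℝ) 1, ψ ((1 - t) • a + t • b) = ψ' ((1 - t) • a' + t • b')) :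
    seg F ψ a b = seg F ψ' a' b' := by
  unfold seg
  congr 1
  ext p
  have h1 := p.2.2
  rw [Fin.sum_univ_two] at h1
  have h0 : p.1 0 = 1 - p.1 1 := by linarith
  have := h (p.1 1) ⟨p.2.1 1, by linarith [p.2.1 0]⟩
  rw [← h0] at this
  simpa [affine, Fin.sum_univ_two] using this

theorem seg_const (x : X) (ψ : C(E, X)) (a b : E)
    (h : ∀ t ∈ Set.Icc (0 : ℝ) 1, ψ ((1 - t) • a + t • b) = x) :
    seg F ψ a b ∈ Boundaries F X := by
  have : seg F ψ a b = seg F (ContinuousMap.const ℝ x) 0 0 := seg_congr F (by simpa using h)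
  rw [this]
  exact seg_self F _ _

/-- Every singular 1-simplex is a path. -/
theorem exists_seg (σ : C(stdSimplex ℝ (Fin 2), X)) : ∃ c : C(ℝ, X), single F σ = seg F c 0 1 := by
  let u : ℝ → stdSimplex ℝ (Fin 2) := fun t =>
    ⟨![1 - Set.projIcc (0 : ℝ) 1 zero_le_one t, Set.projIcc (0 : ℝ) 1 zero_le_one t], by
      have := (Set.projIcc (0 : ℝ) 1 zero_le_one t).2
      refine ⟨fun i => ?_, by simp⟩
      fin_cases i
      · simpa using this.2
      · simpa using this.1⟩
  have hu : Continuous u := by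
    refine Continuous.subtype_mk (continuous_pi fun i => ?_) _
    have h := continuous_subtype_val.comp (continuous_projIcc (h := zero_le_one (α := ℝ)))
    fin_cases i
    · exact continuous_const.sub h
    · exact h
  refine ⟨σ.comp ⟨u, hu⟩, ?_⟩
  unfold seg
  congr 1
  ext p
  have h1 := p.2.2
  rw [Fin.sum_univ_two] at h1
  have h2 : p.1 1 ∈ Set.Icc (0 : ℝ) 1 := ⟨p.2.1 1, by linarith [p.2.1 0]⟩
  change σ p = σ (u (affine ![0, 1] p))
  congr 1
  have h3 : (Set.projIcc (0 : ℝ) 1 zero_le_one (p.1 1) : ℝ) = p.1 1 := by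
    rw [Set.projIcc_of_mem _ h2]
  have h4 : affine ![(0 : ℝ), 1] p = p.1 1 := by simp [affine, Fin.sum_univ_two]
  rw [h4]
  refine Subtype.ext (funext fun i => ?_)
  fin_cases i
  · change p.1 0 = 1 - _
    rw [h3]; linarith
  · exact h3.symm

/-- The quotient map by S vanishes on the generators, which are all paths by `exists_seg`. -/
theorem mem_of_forall_seg_mem (z : (cpx F X).X 1)
    (S : Submodule F ((cpx F X).X 1)) (h : ∀ c : C(ℝ, X), seg F c 0 1 ∈ S) : z ∈ S := by
  have : S.mkQ = 0 := hom_ext F fun σ => by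
    obtain ⟨c, hc⟩ := exists_seg F σ
    rw [hc]
    simpa using h c
  simpa using congrArg (fun φ => φ z) this

end SingularChain

/-! ### Cycles decomposed into paths, and winding numbers -/

namespace SingularChain

variable (F : Type) [Field F] {X : Type} [TopologicalSpace X] {Y : Type} [TopologicalSpace Y]

/-- If every path is homologous to a chain in `S`, up to a term which depends on its end points,
then every cycle is homologous to a chain in `S`. -/
theorem push_mem_of_forall_seg (f : C(X, Y)) (Q : X → (cpx F Y).X 1)
    (S : Submodule F ((cpx F Y).X 1))
    (h : ∀ c : C(ℝ, X), seg F (f.comp c) 0 1 - (Q (c 1) - Q (c 0)) ∈ S)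
    {z : (cpx F X).X 1} (hz : z ∈ Cycles F X) : push F 1 f z ∈ S := by
  -- Extend Q linearly to 0-chains. The push-forward minus φ ∘ d takes values in S, and the
  -- correction vanishes on cycles.
  obtain ⟨φ, hφ⟩ := exists_lift F (n := 0) (X := X) (fun σ => Q (σ default))
  have hp : ∀ x, φ (pt F x) = Q x := fun x => hφ _
  have key : ∀ x : (cpx F X).X 1, x ∈ S.comap (push F 1 f - φ ∘ₗ ((cpx F X).d 1 0).hom) := by
    intro x
    refine mem_of_forall_seg_mem F x _ fun c => ?_
    rw [Submodule.mem_comap, LinearMap.sub_apply, LinearMap.comp_apply, d_seg, map_sub, hp, hp,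
      push_seg]
    exact h c
  have := key z
  rw [Submodule.mem_comap, LinearMap.sub_apply, LinearMap.comp_apply, LinearMap.mem_ker.1 hz,
    map_zero, sub_zero] at this
  exact this

/-- Lifts of simplices to the universal covering of the circle. -/
theorem exists_simplex_lift {n : ℕ} (σ : C(stdSimplex ℝ (Fin (n + 1)), UnitAddCircle)) :
    ∃ l : C(stdSimplex ℝ (Fin (n + 1)), ℝ), ∀ p, (l p : UnitAddCircle) = σ p := by
  have hc : Convex ℝ (stdSimplex ℝ (Fin (n + 1))) := convex_stdSimplex _ _
  have : LocallyPathConnectedSpace (stdSimplex ℝ (Fin (n + 1))) := hc.locallyPathConnectedSpace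
  have : ContractibleSpace (stdSimplex ℝ (Fin (n + 1))) := hc.contractibleSpace ⟨_, (stdSimplex.vertex 0).2⟩
  obtain ⟨e, he⟩ := QuotientAddGroup.mk_surjective (σ (stdSimplex.vertex 0))
  obtain ⟨l, hl, -⟩ := (AddCircle.isCoveringMap_coe (1 : ℝ)).existsUnique_continuousMap_lifts
    σ (stdSimplex.vertex 0) e he
  exact ⟨l, fun p => congrFun hl.2 p⟩

/-- Two lifts on a connected space differ by a constant integer, which the floor function carries
along. -/
theorem floor_sub_floor_eq {A : Type*} [TopologicalSpace A] [PreconnectedSpace A] (l m : C(A, ℝ))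
    (h : ∀ p, (l p : UnitAddCircle) = m p) (p q : A) : ⌊l p⌋ - ⌊l q⌋ = ⌊m p⌋ - ⌊m q⌋ := by
  obtain ⟨k, hk⟩ : ∃ k : ℤ, l q - m q = k := by
    obtain ⟨k, hk⟩ := QuotientAddGroup.eq.1 (h q).symm
    refine ⟨k, ?_⟩
    simp at hk
    linarith
  have h1 : l p = m p + k := by
    refine congrFun ((AddCircle.isCoveringMap_coe (1 : ℝ)).eq_of_comp_eq (g₁ := l)
      (g₂ := fun p => m p + k) l.continuous (by fun_prop) (funext fun p => ?_) q (by linarith)) p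
    simp [h p]
  have h2 : l q = m q + k := by linarith
  rw [h1, h2, Int.floor_add_intCast, Int.floor_add_intCast]
  ring

/-- The winding number with respect to a map to the circle, as a cocycle. -/
theorem exists_winding (f : C(X, UnitAddCircle)) :
    ∃ W : (cpx F X).X 1 →ₗ[F] F, (∀ z ∈ Boundaries F X, W z = 0) ∧
      ∀ (c : C(ℝ, X)) (l : C(ℝ, ℝ)), (∀ t ∈ Set.Icc (0 : ℝ) 1, (l t : UnitAddCircle) = f (c t)) →
        W (seg F c 0 1) = ((⌊l 1⌋ - ⌊l 0⌋ : ℤ) : F) := by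
  classical
  choose L hL using fun σ : C(stdSimplex ℝ (Fin 2), UnitAddCircle) => exists_simplex_lift σ
  have : ∀ n, PreconnectedSpace (stdSimplex ℝ (Fin (n + 1))) := fun n =>
    Subtype.preconnectedSpace (convex_stdSimplex ℝ (Fin (n + 1))).isPreconnected
  let v : Fin 2 → stdSimplex ℝ (Fin 2) := fun i => stdSimplex.vertex i
  -- Taking floors makes the increment of a lift an integer, hence an element of F, also for paths
  -- that are not closed. On closed paths nothing changes.
  obtain ⟨W, hW⟩ := exists_lift F (n := 1) (X := X) (M := F) fun σ =>
    ((⌊L (f.comp σ) (v 1)⌋ - ⌊L (f.comp σ) (v 0)⌋ : ℤ) : F)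
  have hW' : ∀ (σ : C(stdSimplex ℝ (Fin 2), X)) (l : C(stdSimplex ℝ (Fin 2), ℝ)),
      (∀ p, (l p : UnitAddCircle) = f (σ p)) →
      W (single F σ) = ((⌊l (v 1)⌋ - ⌊l (v 0)⌋ : ℤ) : F) := by
    intro σ l hl
    rw [hW, floor_sub_floor_eq (L (f.comp σ)) l (fun p => (hL _ p).trans (hl p).symm)]
  refine ⟨W, ?_, fun c l hl => ?_⟩
  · rintro _ ⟨x, rfl⟩
    have : W ∘ₗ ((cpx F X).d 2 1).hom = 0 := hom_ext F fun τ => by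
      -- A single lift on the 2-simplex serves all three faces, so the differences of floors at the
      -- vertices cancel.
      obtain ⟨l, hl⟩ := exists_simplex_lift (f.comp τ)
      have hw : ∀ i, W (single F (τ.comp (face 1 i))) =
          ((⌊l (face 1 i (v 1))⌋ - ⌊l (face 1 i (v 0))⌋ : ℤ) : F) := fun i =>
        hW' (τ.comp (face 1 i)) (l.comp (face 1 i)) fun p => hl _
      have hv : ∀ i j, face 1 i (v j) = stdSimplex.vertex (i.succAbove j) := fun i j => by
        simp [face, v]
      have e00 : (0 : Fin 3).succAbove (0 : Fin 2) = 1 := rfl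
      have e01 : (0 : Fin 3).succAbove (1 : Fin 2) = 2 := rfl
      have e10 : (1 : Fin 3).succAbove (0 : Fin 2) = 0 := rfl
      have e11 : (1 : Fin 3).succAbove (1 : Fin 2) = 2 := rfl
      have e20 : (2 : Fin 3).succAbove (0 : Fin 2) = 0 := rfl
      have e21 : (2 : Fin 3).succAbove (1 : Fin 2) = 1 := rfl
      rw [LinearMap.comp_apply, d_single, Fin.sum_univ_three, map_add, map_add, map_smul, map_smul,
        map_smul, hw, hw, hw]
      simp only [hv, e00, e01, e10, e11, e20, e21]
      push_cast
      simp
    exact congrArg (fun φ => φ x) this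
  · have := hW' (c.comp (affine ![0, 1])) (l.comp (affine ![0, 1])) fun p => by
      have h1 := p.2.2
      rw [Fin.sum_univ_two] at h1
      refine hl _ ?_
      simp [affine, Fin.sum_univ_two]
      exact ⟨p.2.1 1, by linarith [p.2.1 0]⟩
    rw [seg, this]
    simp [v, affine, Fin.sum_univ_two]

/-! ### Homology classes of cycles -/

open AlgebraicTopology in
/-- The homology class of a singular 1-cycle. -/
noncomputable def cls : Cycles F X →ₗ[F]
    (((singularHomologyFunctor (ModuleCat.{0} F) 1).obj (ModuleCat.of F F)).obj (TopCat.of X)) :=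
  (cpx F X).homologyClassOne

theorem cls_surjective : Function.Surjective (cls F (X := X)) :=
  (cpx F X).homologyClassOne_surjective

theorem cls_eq_zero_iff (z : Cycles F X) : cls F z = 0 ↔ z.1 ∈ Boundaries F X :=
  (cpx F X).homologyClassOne_eq_zero_iff z

open AlgebraicTopology in
theorem map_cls (f : C(X, Y)) (z : Cycles F X) :
    (((singularHomologyFunctor (ModuleCat.{0} F) 1).obj (ModuleCat.of F F)).map
      (TopCat.ofHom f)).hom (cls F z) = cls F ⟨push F 1 f z, push_mem_cycles F f z.2⟩ :=
  ChainComplex.homologyMap_homologyClassOne (cpxMap F f) z _ rfl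

end SingularChain

/-! ### Sublevel inclusions on classes of cycles -/

section Sublevel

open SingularChain

variable (F : Type) [Field F] {X : Type} [TopologicalSpace X] (g : X → ℝ)

/-- The inclusion of sublevel sets. -/
def sublevelIncl {s t : ℝ} (h : s ≤ t) : C({x // g x ≤ s}, {x // g x ≤ t}) :=
  ⟨fun x => ⟨x.1, x.2.trans h⟩, by fun_prop⟩

theorem sublevelHomology_map_cls {s t : ℝ} (h : s ≤ t) (z : Cycles F {x // g x ≤ s}) :
    ((sublevelHomology F 1 g).map (homOfLE h)).hom (cls F z) =
      cls F ⟨push F 1 (sublevelIncl g h) z, push_mem_cycles F _ z.2⟩ :=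
  map_cls F (sublevelIncl g h) z

end Sublevel

/-! ### Existence of persistence diagrams -/

/-- The cells are the gaps between consecutive elements of A, each marked by a point strictly
inside. Increments telescope over the gaps, and a gap lies in [a, b] exactly when its mark does. -/
theorem Finset.exists_telescoping_cells {α : Type*} [LinearOrder α] [DenselyOrdered α]
    (A : Finset α) : ∃ C : Finset (α × α × α),
      (∀ c ∈ C, c.1 ∈ A ∧ c.2.2 ∈ A ∧ c.1 < c.2.1 ∧ c.2.1 < c.2.2) ∧
      ∀ (f : α → ℤ), ∀ a ∈ A, ∀ b ∈ A, a ≤ b →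
        f b - f a = ∑ c ∈ C with c.2.1 ∈ Set.Icc a b, (f c.2.2 - f c.1) := by
  classical
  induction A using Finset.induction_on_max with
  | empty => exact ⟨∅, by simp⟩
  | insert x A hx ih =>
    obtain ⟨C, hC, hf⟩ := ih
    rcases A.eq_empty_or_nonempty with rfl | hne
    · refine ⟨∅, by simp, ?_⟩
      intro f a ha b hb _
      simp at ha hb
      simp [ha, hb]
    obtain ⟨m, hm1, hm2⟩ := _root_.exists_between (hx _ (A.max'_mem hne))
    have hle : ∀ a ∈ A, a ≤ A.max' hne := fun a ha => A.le_max' a ha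
    have hnew : (A.max' hne, m, x) ∉ C := fun h => (hx _ (hC _ h).2.1).false
    refine ⟨insert (A.max' hne, m, x) C, ?_, ?_⟩
    · intro c hc
      rcases Finset.mem_insert.1 hc with rfl | hc
      · exact ⟨Finset.mem_insert_of_mem (A.max'_mem hne), Finset.mem_insert_self _ _, hm1, hm2⟩
      · obtain ⟨h1, h2, h3⟩ := hC c hc
        exact ⟨Finset.mem_insert_of_mem h1, Finset.mem_insert_of_mem h2, h3⟩
    · intro f a ha b hb hab
      rcases Finset.mem_insert.1 hb with rfl | hbA
      · rcases Finset.mem_insert.1 ha with rfl | haA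
        · rw [sub_self, Finset.filter_eq_empty_iff.2, Finset.sum_empty]
          intro c hc hcm
          rcases Finset.mem_insert.1 hc with rfl | hc
          · exact (hcm.1.trans_lt hm2).false
          · exact ((hcm.1.trans_lt (hC c hc).2.2.2).trans (hx _ (hC c hc).2.1)).false
        · rw [Finset.filter_insert, if_pos ⟨(hle a haA).trans hm1.le, hm2.le⟩,
            Finset.sum_insert (fun h => hnew (Finset.mem_filter.1 h).1)]
          have := hf f a haA _ (A.max'_mem hne) (hle a haA)
          rw [Finset.filter_congr (q := fun c => c.2.1 ∈ Set.Icc a (A.max' hne))]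
          · linarith
          · intro c hc
            have h1 := (hC c hc).2.2.2
            have h2 := hle _ (hC c hc).2.1
            have h3 := hx _ (hC c hc).2.1
            exact ⟨fun h => ⟨h.1, h1.le.trans h2⟩, fun h => ⟨h.1, (h1.trans h3).le⟩⟩
      · have haA : a ∈ A := by
          rcases Finset.mem_insert.1 ha with rfl | h
          · exact absurd (hx b hbA) (not_lt.2 hab)
          · exact h
        rw [Finset.filter_insert, if_neg, hf f a haA b hbA hab]
        exact fun h => ((h.2.trans (hle b hbA)).trans_lt hm1).false

namespace EReal

theorem exists_Icc_mem_nhds_subset {x : EReal} {U : Set EReal} (hU : U ∈ 𝓝 x) :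
    ∃ a b, a < b ∧ Set.Icc a b ∈ 𝓝 x ∧ Set.Icc a b ⊆ U := by
  obtain ⟨a, b, hm, hn, hs⟩ := exists_Icc_mem_subset_of_mem_nhds hU
  refine ⟨a, b, lt_of_le_of_ne (hm.1.trans hm.2) ?_, hn, hs⟩
  rintro rfl
  obtain rfl : x = a := le_antisymm hm.2 hm.1
  rw [Set.Icc_self] at hn
  have hc : IsClopen ({x} : Set EReal) := ⟨isClosed_singleton, by
    rw [isOpen_iff_mem_nhds]; rintro _ rfl; exact hn⟩
  rcases isClopen_iff.1 hc with h | h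
  · simp at h
  · have h1 : (⊥ : EReal) ∈ ({x} : Set EReal) := h ▸ Set.mem_univ _
    have h2 : (⊤ : EReal) ∈ ({x} : Set EReal) := h ▸ Set.mem_univ _
    rw [Set.mem_singleton_iff] at h1 h2
    exact bot_lt_top.ne (h1.trans h2.symm)

theorem exists_rectangle_mem_nhds_subset {z : EReal × EReal} (hz : z.1 < z.2)
    {U : Set (EReal × EReal)} (hU : U ∈ 𝓝 z) : ∃ a b c d, a < b ∧ b < c ∧ c < d ∧
      Set.Icc a b ×ˢ Set.Icc c d ∈ 𝓝 z ∧ Set.Icc a b ×ˢ Set.Icc c d ⊆ U := by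
  obtain ⟨m, hxm, hmy⟩ := exists_between hz
  obtain ⟨x, y⟩ := z
  rw [nhds_prod_eq, Filter.mem_prod_iff] at hU
  obtain ⟨A, hA, B, hB, hAB⟩ := hU
  obtain ⟨a, b, hab, hnx, hsx⟩ :=
    exists_Icc_mem_nhds_subset (Filter.inter_mem hA (Iio_mem_nhds hxm))
  obtain ⟨c, d, hcd, hny, hsy⟩ :=
    exists_Icc_mem_nhds_subset (Filter.inter_mem hB (Ioi_mem_nhds hmy))
  refine ⟨a, b, c, d, hab, lt_trans (hsx ⟨hab.le, le_rfl⟩).2 (hsy ⟨le_rfl, hcd.le⟩).2, hcd,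
    ?_, ?_⟩
  · rw [nhds_prod_eq]
    exact Filter.prod_mem_prod hnx hny
  · exact fun w hw => hAB ⟨(hsx hw.1).1, (hsy hw.2).1⟩

end EReal

/-- Rank-nullity for g restricted to the range of f; the last term counts the classes which die
under g. -/
theorem LinearMap.finrank_range_eq_add {K A B C : Type*} [Field K] [AddCommGroup A] [Module K A]
    [AddCommGroup B] [Module K B] [AddCommGroup C] [Module K C] (f : A →ₗ[K] B) (g : B →ₗ[K] C)
    [FiniteDimensional K (LinearMap.range f)] :
    Module.finrank K (LinearMap.range f) = Module.finrank K (LinearMap.range (g ∘ₗ f)) +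
      Module.finrank K (LinearMap.range f ⊓ LinearMap.ker g : Submodule K B) := by
  have h := LinearMap.finrank_range_add_finrank_ker (g.domRestrict (LinearMap.range f))
  have h1 : LinearMap.range (g.domRestrict (LinearMap.range f)) = LinearMap.range (g ∘ₗ f) := by
    rw [LinearMap.range_domRestrict, LinearMap.range_comp]
  have h2 : LinearMap.ker (g.domRestrict (LinearMap.range f)) =
      (LinearMap.range f ⊓ LinearMap.ker g).comap (LinearMap.range f).subtype := by
    ext x; simp
  rw [h1, h2, (Submodule.comapSubtypeEquivOfLe inf_le_left).finrank_eq] at h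
  exact h.symm

namespace PersistenceModule

variable {F : Type} [Field F] {V : PersistenceModule F}

theorem map_comp_hom (V : PersistenceModule F) {r s t : ℝ} (h : r ≤ s) (h' : s ≤ t) :
    (V.map (homOfLE (h.trans h'))).hom =
      (V.map (homOfLE h')).hom ∘ₗ (V.map (homOfLE h)).hom := by
  rw [← ModuleCat.hom_comp, ← V.map_comp]; rfl

theorem rank_coe (V : PersistenceModule F) {s t : ℝ} (h : s ≤ t) :
    V.rank s t = Module.finrank F (LinearMap.range (V.map (homOfLE h)).hom) := by
  rw [rank, dif_pos ⟨EReal.coe_ne_bot s, EReal.coe_ne_top t, h⟩]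
  rfl

@[simp] theorem rank_bot (V : PersistenceModule F) (t : EReal) : V.rank ⊥ t = 0 := by
  simp [rank]

@[simp] theorem rank_top (V : PersistenceModule F) (s : EReal) : V.rank s ⊤ = 0 := by
  simp [rank]

theorem measure_nonneg (hV : V.IsQTame) {a b c d : EReal} (hab : a < b) (hbc : b < c)
    (hcd : c < d) : 0 ≤ V.measure a b c d := by
  induction b with
  | bot => simp at hab
  | top => simp at hbc
  | coe b =>
  induction c with
  | bot => simp at hbc
  | top => simp at hcd
  | coe c =>
  have hbc' : b < c := EReal.coe_lt_coe_iff.1 hbc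
  have := hV b c hbc'
  -- K consists of the classes at c that die by d, hence of everything if d = ∞. The measure is then
  -- the growth of the intersection of K with the image from e, as e moves from a to b.
  obtain ⟨K, hK⟩ : ∃ K : Submodule F (V.obj c), ∀ e : ℝ, (he : e ≤ b) →
      (V.rank e c : ℤ) = V.rank e d + Module.finrank F
        (LinearMap.range (V.map (homOfLE (he.trans hbc'.le))).hom ⊓ K : Submodule F (V.obj c)) := by
    induction d with
    | bot => simp at hcd
    | top =>
      refine ⟨⊤, fun e he => ?_⟩
      rw [rank_top, inf_top_eq, rank_coe V (he.trans hbc'.le)]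
      simp
    | coe d =>
      have hcd' : c < d := EReal.coe_lt_coe_iff.1 hcd
      refine ⟨LinearMap.ker (V.map (homOfLE hcd'.le)).hom, fun e he => ?_⟩
      have := hV e c (he.trans_lt hbc')
      rw [rank_coe V (he.trans hbc'.le), rank_coe V ((he.trans hbc'.le).trans hcd'.le),
        map_comp_hom V (he.trans hbc'.le) hcd'.le, ← Nat.cast_add,
        LinearMap.finrank_range_eq_add _ (V.map (homOfLE hcd'.le)).hom]
  induction a with
  | top => simp at hab
  | bot =>
    have := hK b le_rfl
    simp only [measure, rank_bot]
    omega
  | coe a =>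
    have hab' : a < b := EReal.coe_lt_coe_iff.1 hab
    have h1 := hK b le_rfl
    have h2 := hK a hab'.le
    have h3 : Module.finrank F (LinearMap.range (V.map (homOfLE (hab'.le.trans hbc'.le))).hom ⊓ K :
        Submodule F (V.obj c)) ≤ Module.finrank F (LinearMap.range
          (V.map (homOfLE (le_rfl.trans hbc'.le))).hom ⊓ K : Submodule F (V.obj c)) := by
      have : FiniteDimensional F (LinearMap.range
          (V.map (homOfLE (le_rfl.trans hbc'.le))).hom ⊓ K : Submodule F (V.obj c)) :=
        Submodule.finiteDimensional_inf_left _ _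
      refine Submodule.finrank_mono (inf_le_inf_right _ ?_)
      rw [map_comp_hom V hab'.le hbc'.le]
      exact LinearMap.range_comp_le_range _ _
    simp only [measure]
    omega

/-- On finitely many rectangles, the persistence measure is given by finitely many atoms. -/
theorem exists_atoms (hV : V.IsQTame) (A B : Finset EReal) (hAB : ∀ x ∈ A, ∀ y ∈ B, x < y) :
    ∃ (ι : Type) (I : Finset ι) (p : ι → EReal × EReal) (w : ι → ℤ), (∀ i ∈ I, 0 ≤ w i) ∧
      ∀ a ∈ A, ∀ b ∈ A, ∀ c ∈ B, ∀ d ∈ B, a ≤ b → c ≤ d → ∀ J : Finset ι,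
        (∀ i, i ∈ J ↔ i ∈ I ∧ p i ∈ Set.Icc a b ×ˢ Set.Icc c d) →
        V.measure a b c d = ∑ i ∈ J, w i := by
  classical
  obtain ⟨C, hC, hf⟩ := A.exists_telescoping_cells
  obtain ⟨D, hD, hg⟩ := B.exists_telescoping_cells
  -- The atoms sit at the marks of the grid cells, and each weighs the measure of its cell.
  refine ⟨_, C ×ˢ D, fun i => (i.1.2.1, i.2.2.1),
    fun i => V.measure i.1.1 i.1.2.2 i.2.1 i.2.2.2, ?_, ?_⟩
  · intro i hi
    obtain ⟨h1, h2⟩ := Finset.mem_product.1 hi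
    obtain ⟨h1, h2, h3, h4⟩ := hC _ h1
    obtain ⟨h1', h2', h3', h4'⟩ := hD _ ‹_›
    exact measure_nonneg hV (h3.trans h4) (hAB _ h2 _ h1') (h3'.trans h4')
  · intro a ha b hb c hc d hd hab hcd J hJ
    have hJ' : J = (C.filter fun c => c.2.1 ∈ Set.Icc a b) ×ˢ
        (D.filter fun e => e.2.1 ∈ Set.Icc c d) := by
      ext i
      rw [hJ]
      simp only [Finset.mem_product, Finset.mem_filter, Set.mem_prod]
      tauto
    rw [hJ', Finset.sum_product]
    have h1 := hf (fun x => (V.rank x c - V.rank x d : ℤ)) a ha b hb hab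
    have h2 : V.measure a b c d = (V.rank b c - V.rank b d : ℤ) - (V.rank a c - V.rank a d) := by
      simp only [measure]; ring
    rw [h2, h1]
    refine Finset.sum_congr rfl fun k _ => ?_
    have h3 := hg (fun y => (V.rank k.1 y - V.rank k.2.2 y : ℤ)) c hc d hd hcd
    have h4 : (V.rank k.2.2 c - V.rank k.2.2 d : ℤ) - (V.rank k.1 c - V.rank k.1 d) =
      (V.rank k.1 d - V.rank k.2.2 d : ℤ) - (V.rank k.1 c - V.rank k.2.2 c) := by ring
    rw [h4, h3]
    refine Finset.sum_congr rfl fun e _ => ?_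
    simp only [measure]; ring

/-- In a common grid, the larger rectangle contains more atoms, and their weights are nonnegative.
-/
theorem measure_mono (hV : V.IsQTame) {a b c d a' b' c' d' : EReal} (hab : a ≤ b)
    (hcd : c ≤ d) (hbc : b' < c')
    (h : Set.Icc a b ×ˢ Set.Icc c d ⊆ Set.Icc a' b' ×ˢ Set.Icc c' d') :
    V.measure a b c d ≤ V.measure a' b' c' d' := by
  classical
  have h1 : (a, c) ∈ Set.Icc a' b' ×ˢ Set.Icc c' d' := h ⟨⟨le_rfl, hab⟩, ⟨le_rfl, hcd⟩⟩
  have h2 : (b, d) ∈ Set.Icc a' b' ×ˢ Set.Icc c' d' := h ⟨⟨hab, le_rfl⟩, ⟨hcd, le_rfl⟩⟩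
  obtain ⟨⟨ha1, ha2⟩, hc1, hc2⟩ := h1
  obtain ⟨⟨hb1, hb2⟩, hd1, hd2⟩ := h2
  simp only at ha1 ha2 hc1 hc2 hb1 hb2 hd1 hd2
  obtain ⟨ι, I, p, w, hw, hm⟩ := exists_atoms hV {a, b, a', b'} {c, d, c', d'} (by
    have key : ∀ x ∈ ({a, b, a', b'} : Finset EReal), x ≤ b' := by
      simp [ha2, hb2, ha1.trans ha2]
    have key' : ∀ x ∈ ({c, d, c', d'} : Finset EReal), c' ≤ x := by
      simp [hc1, hd1, hc1.trans hc2]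
    exact fun x hx y hy => ((key x hx).trans_lt hbc).trans_le (key' y hy))
  rw [hm a (by simp) b (by simp) c (by simp) d (by simp) hab hcd
      (I.filter fun i => p i ∈ Set.Icc a b ×ˢ Set.Icc c d) (by simp),
    hm a' (by simp) b' (by simp) c' (by simp) d' (by simp) (ha1.trans ha2) (hc1.trans hc2)
      (I.filter fun i => p i ∈ Set.Icc a' b' ×ˢ Set.Icc c' d') (by simp)]
  refine Finset.sum_le_sum_of_subset_of_nonneg (fun i hi => ?_)
    fun i hi _ => hw i (Finset.mem_filter.1 hi).1
  rw [Finset.mem_filter] at hi ⊢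
  exact ⟨hi.1, h hi.2⟩

open Classical in
/-- The multiplicity of a point, as the minimal measure of a rectangle around it. -/
noncomputable def multiplicity (V : PersistenceModule F) (z : EReal × EReal) : ℕ :=
  if z.1 < z.2 then sInf {n : ℕ | ∃ a b c d, a < b ∧ b < c ∧ c < d ∧
    Set.Icc a b ×ˢ Set.Icc c d ∈ 𝓝 z ∧ V.measure a b c d = n} else 0

/-- The minimum is attained by some rectangle around z. By monotonicity it is also attained by each
smaller one, so the rectangle can be taken inside U. -/
theorem exists_measure_eq_multiplicity (hV : V.IsQTame) {z : EReal × EReal} (hz : z.1 < z.2)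
    {U : Set (EReal × EReal)} (hU : U ∈ 𝓝 z) : ∃ a b c d, a < b ∧ b < c ∧ c < d ∧
      Set.Icc a b ×ˢ Set.Icc c d ∈ 𝓝 z ∧ Set.Icc a b ×ˢ Set.Icc c d ⊆ U ∧
      V.measure a b c d = V.multiplicity z := by
  have hne : {n : ℕ | ∃ a b c d, a < b ∧ b < c ∧ c < d ∧
      Set.Icc a b ×ˢ Set.Icc c d ∈ 𝓝 z ∧ V.measure a b c d = n}.Nonempty := by
    obtain ⟨a, b, c, d, h1, h2, h3, h4, -⟩ := EReal.exists_rectangle_mem_nhds_subset hz hU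
    exact ⟨(V.measure a b c d).toNat, a, b, c, d, h1, h2, h3, h4,
      (Int.toNat_of_nonneg (measure_nonneg hV h1 h2 h3)).symm⟩
  have hmem := Nat.sInf_mem hne
  have hdef : V.multiplicity z = sInf _ := if_pos hz
  rw [← hdef] at hmem
  obtain ⟨a', b', c', d', h1', h2', h3', h4', h5'⟩ := hmem
  obtain ⟨a, b, c, d, h1, h2, h3, h4, h5⟩ :=
    EReal.exists_rectangle_mem_nhds_subset hz (Filter.inter_mem hU h4')
  refine ⟨a, b, c, d, h1, h2, h3, h4, h5.trans Set.inter_subset_left, le_antisymm ?_ ?_⟩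
  · rw [← h5']
    exact measure_mono hV h1.le h3.le h2' (h5.trans Set.inter_subset_right)
  · rw [hdef, ← Int.toNat_of_nonneg (measure_nonneg hV h1 h2 h3)]
    exact Nat.cast_le.2 (Nat.sInf_le ⟨a, b, c, d, h1, h2, h3, h4,
      (Int.toNat_of_nonneg (measure_nonneg hV h1 h2 h3)).symm⟩)

/-- Surround the points by disjoint rectangles that realize the multiplicities. In a common grid
they use disjoint sets of atoms of the large rectangle. -/
theorem sum_multiplicity_le (hV : V.IsQTame) {a b c d : EReal} (hab : a < b) (hbc : b < c)
    (hcd : c < d) (Z : Finset (EReal × EReal))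
    (hZ : ∀ z ∈ Z, z ∈ interior (Set.Icc a b ×ˢ Set.Icc c d)) :
    ((∑ z ∈ Z, V.multiplicity z : ℕ) : ℤ) ≤ V.measure a b c d := by
  classical
  obtain ⟨U, hU, hdisj⟩ := Z.finite_toSet.t2_separation
  have hex : ∀ z : EReal × EReal, ∃ a' b' c' d' : EReal, z ∈ Z → (a' < b' ∧ b' < c' ∧ c' < d' ∧
      Set.Icc a' b' ×ˢ Set.Icc c' d' ⊆ U z ∩ Set.Icc a b ×ˢ Set.Icc c d ∧
      V.measure a' b' c' d' = V.multiplicity z) := by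
    intro z
    by_cases hz : z ∈ Z
    · have hzi := mem_interior_iff_mem_nhds.1 (hZ z hz)
      have hzR := mem_of_mem_nhds hzi
      obtain ⟨a', b', c', d', h1, h2, h3, -, h5, h6⟩ := exists_measure_eq_multiplicity hV
        ((hzR.1.2.trans_lt hbc).trans_le hzR.2.1)
        (Filter.inter_mem ((hU z).2.mem_nhds (hU z).1) hzi)
      exact ⟨a', b', c', d', fun _ => ⟨h1, h2, h3, h5, h6⟩⟩
    · exact ⟨a, a, a, a, fun h => absurd h hz⟩
  choose a' b' c' d' h using hex
  have hl : ∀ z ∈ Z, (a ≤ a' z ∧ b' z ≤ b) ∧ c ≤ c' z ∧ d' z ≤ d := fun z hz => by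
    obtain ⟨h1, h2, h3, h4, -⟩ := h z hz
    have k1 := (h4 (⟨⟨le_rfl, h1.le⟩, ⟨le_rfl, h3.le⟩⟩ : (a' z, c' z) ∈ Set.Icc (a' z) (b' z) ×ˢ Set.Icc (c' z) (d' z))).2
    have k2 := (h4 (⟨⟨h1.le, le_rfl⟩, ⟨h3.le, le_rfl⟩⟩ : (b' z, d' z) ∈ Set.Icc (a' z) (b' z) ×ˢ Set.Icc (c' z) (d' z))).2
    exact ⟨⟨k1.1.1, k2.1.2⟩, k1.2.1, k2.2.2⟩
  obtain ⟨ι, I, p, w, hw, hm⟩ := exists_atoms hV (insert a (insert b (Z.image a' ∪ Z.image b')))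
    (insert c (insert d (Z.image c' ∪ Z.image d'))) (by
      have key : ∀ x ∈ insert a (insert b (Z.image a' ∪ Z.image b')), x ≤ b := by
        intro x hx
        simp only [Finset.mem_insert, Finset.mem_union, Finset.mem_image] at hx
        rcases hx with rfl | rfl | ⟨z, hz, rfl⟩ | ⟨z, hz, rfl⟩
        · exact hab.le
        · exact le_rfl
        · exact (h z hz).1.le.trans (hl z hz).1.2
        · exact (hl z hz).1.2
      have key' : ∀ x ∈ insert c (insert d (Z.image c' ∪ Z.image d')), c ≤ x := by
        intro x hx
        simp only [Finset.mem_insert, Finset.mem_union, Finset.mem_image] at hx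
        rcases hx with rfl | rfl | ⟨z, hz, rfl⟩ | ⟨z, hz, rfl⟩
        · exact le_rfl
        · exact hcd.le
        · exact (hl z hz).2.1
        · exact (hl z hz).2.1.trans (h z hz).2.2.1.le
      exact fun x hx y hy => ((key x hx).trans_lt hbc).trans_le (key' y hy))
  rw [hm a (by simp) b (by simp) c (by simp) d (by simp) hab.le hcd.le
    (I.filter fun i => p i ∈ Set.Icc a b ×ˢ Set.Icc c d) (by simp), Nat.cast_sum]
  have hz : ∀ z ∈ Z, (V.multiplicity z : ℤ) =
      ∑ i ∈ I.filter fun i => p i ∈ Set.Icc (a' z) (b' z) ×ˢ Set.Icc (c' z) (d' z), w i := by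
    intro z hz
    rw [← (h z hz).2.2.2.2]
    refine hm _ ?_ _ ?_ _ ?_ _ ?_ (h z hz).1.le (h z hz).2.2.1.le _ (by simp)
    all_goals
      simp only [Finset.mem_insert, Finset.mem_union, Finset.mem_image]
    · exact .inr (.inr (.inl ⟨z, hz, rfl⟩))
    · exact .inr (.inr (.inr ⟨z, hz, rfl⟩))
    · exact .inr (.inr (.inl ⟨z, hz, rfl⟩))
    · exact .inr (.inr (.inr ⟨z, hz, rfl⟩))
  rw [Finset.sum_congr rfl hz, ← Finset.sum_biUnion]
  · refine Finset.sum_le_sum_of_subset_of_nonneg (fun i hi => ?_)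
      fun i hi _ => hw i (Finset.mem_filter.1 hi).1
    simp only [Finset.mem_biUnion, Finset.mem_filter] at hi ⊢
    obtain ⟨z, hz, hi, hp⟩ := hi
    exact ⟨hi, ((h z hz).2.2.2.1 hp).2⟩
  · intro z hz z' hz' hne
    rw [Function.onFun, Finset.disjoint_left]
    intro i hi hi'
    exact Set.disjoint_left.1 (hdisj hz hz' hne) ((h z hz).2.2.2.1 (Finset.mem_filter.1 hi).2).1
      ((h z' hz').2.2.2.1 (Finset.mem_filter.1 hi').2).1

theorem finite_support_multiplicity (hV : V.IsQTame) {a b c d : EReal} (hbc : b < c) :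
    (Function.support V.multiplicity ∩ Set.Icc a b ×ˢ Set.Icc c d).Finite := by
  -- The rectangle is interior to [-∞, b'] × [c', ∞], whose measure bounds the number of points of
  -- positive multiplicity.
  obtain ⟨b', hb, hbc'⟩ := exists_between hbc
  obtain ⟨c', hc', hc⟩ := exists_between hbc'
  by_contra hinf
  obtain ⟨Z, hZ, hcard⟩ := Set.Infinite.exists_subset_card_eq hinf
    ((V.measure ⊥ b' c' ⊤).toNat + 1)
  have h1 := sum_multiplicity_le hV (bot_le.trans_lt hb) hc' (hc.trans_le le_top) Z
    (fun z hz => by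
      have := (hZ hz).2
      refine mem_interior.2 ⟨Set.Iio b' ×ˢ Set.Ioi c', fun w hw => ?_, isOpen_Iio.prod isOpen_Ioi,
        this.1.2.trans_lt hb, hc.trans_le this.2.1⟩
      exact ⟨⟨bot_le, hw.1.le⟩, hw.2.le, le_top⟩)
  have h2 : Z.card ≤ ∑ z ∈ Z, V.multiplicity z := by
    rw [Finset.card_eq_sum_ones]
    exact Finset.sum_le_sum fun z hz => Nat.one_le_iff_ne_zero.2 (hZ hz).1
  omega

/-- By compactness, finitely many rectangles realizing multiplicities cover the given one, so each
of its atoms is counted at least once. -/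
theorem measure_le_sum_multiplicity (hV : V.IsQTame) {a b c d : EReal} (hab : a < b)
    (hbc : b < c) (hcd : c < d) : ∃ Z : Finset (EReal × EReal),
      (∀ z ∈ Z, z ∈ Set.Icc a b ×ˢ Set.Icc c d) ∧
      V.measure a b c d ≤ ((∑ z ∈ Z, V.multiplicity z : ℕ) : ℤ) := by
  classical
  -- The covering rectangles may protrude. The separators m < m' keep birth coordinates below death
  -- coordinates, as `exists_atoms` requires.
  obtain ⟨m, hb, hbc'⟩ := exists_between hbc
  obtain ⟨m', hc', hc⟩ := exists_between hbc'
  have hex : ∀ z : EReal × EReal, ∃ a' b' c' d' : EReal, z ∈ Set.Icc a b ×ˢ Set.Icc c d →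
      (a' < b' ∧ b' < c' ∧ c' < d' ∧ Set.Icc a' b' ×ˢ Set.Icc c' d' ∈ 𝓝 z ∧
      Set.Icc a' b' ×ˢ Set.Icc c' d' ⊆ Set.Iio m ×ˢ Set.Ioi m' ∧
      V.measure a' b' c' d' = V.multiplicity z) := by
    intro z
    by_cases hz : z ∈ Set.Icc a b ×ˢ Set.Icc c d
    · obtain ⟨a', b', c', d', h⟩ := exists_measure_eq_multiplicity hV
        ((hz.1.2.trans_lt hbc).trans_le hz.2.1) ((isOpen_Iio.prod isOpen_Ioi).mem_nhds
          (⟨hz.1.2.trans_lt hb, hc.trans_le hz.2.1⟩ : z ∈ Set.Iio m ×ˢ Set.Ioi m'))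
      exact ⟨a', b', c', d', fun _ => h⟩
    · exact ⟨a, a, a, a, fun h => absurd h hz⟩
  choose a' b' c' d' h using hex
  obtain ⟨Z, hZ, hcov⟩ := (isCompact_Icc.prod isCompact_Icc).elim_nhds_subcover
    (fun z => Set.Icc (a' z) (b' z) ×ˢ Set.Icc (c' z) (d' z))
    (fun z (hz : z ∈ Set.Icc a b ×ˢ Set.Icc c d) => (h z hz).2.2.2.1)
  refine ⟨Z, hZ, ?_⟩
  have hl : ∀ z ∈ Z, b' z < m ∧ m' < c' z := fun z hz => by
    obtain ⟨h1, h2, h3, -, h4, -⟩ := h z (hZ z hz)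
    have k1 := (h4 (⟨⟨le_rfl, h1.le⟩, ⟨le_rfl, h3.le⟩⟩ : (a' z, c' z) ∈ Set.Icc (a' z) (b' z) ×ˢ Set.Icc (c' z) (d' z)))
    have k2 := (h4 (⟨⟨h1.le, le_rfl⟩, ⟨h3.le, le_rfl⟩⟩ : (b' z, d' z) ∈ Set.Icc (a' z) (b' z) ×ˢ Set.Icc (c' z) (d' z)))
    exact ⟨k2.1, k1.2⟩
  obtain ⟨ι, I, p, w, hw, hm⟩ := exists_atoms hV (insert a (insert b (Z.image a' ∪ Z.image b')))
    (insert c (insert d (Z.image c' ∪ Z.image d'))) (by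
      have key : ∀ x ∈ insert a (insert b (Z.image a' ∪ Z.image b')), x < m := by
        intro x hx
        simp only [Finset.mem_insert, Finset.mem_union, Finset.mem_image] at hx
        rcases hx with rfl | rfl | ⟨z, hz, rfl⟩ | ⟨z, hz, rfl⟩
        · exact hab.trans hb
        · exact hb
        · exact (h z (hZ z hz)).1.trans (hl z hz).1
        · exact (hl z hz).1
      have key' : ∀ x ∈ insert c (insert d (Z.image c' ∪ Z.image d')), m' < x := by
        intro x hx
        simp only [Finset.mem_insert, Finset.mem_union, Finset.mem_image] at hx
        rcases hx with rfl | rfl | ⟨z, hz, rfl⟩ | ⟨z, hz, rfl⟩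
        · exact hc
        · exact hc.trans hcd
        · exact (hl z hz).2
        · exact (hl z hz).2.trans (h z (hZ z hz)).2.2.1
      exact fun x hx y hy => ((key x hx).trans hc').trans (key' y hy))
  rw [hm a (by simp) b (by simp) c (by simp) d (by simp) hab.le hcd.le
    (I.filter fun i => p i ∈ Set.Icc a b ×ˢ Set.Icc c d) (by simp), Nat.cast_sum]
  have hz : ∀ z ∈ Z, (V.multiplicity z : ℤ) =
      ∑ i ∈ I.filter fun i => p i ∈ Set.Icc (a' z) (b' z) ×ˢ Set.Icc (c' z) (d' z), w i := by
    intro z hz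
    obtain ⟨h1, -, h3, -, -, h6⟩ := h z (hZ z hz)
    rw [← h6]
    refine hm _ ?_ _ ?_ _ ?_ _ ?_ h1.le h3.le _ (by simp)
    all_goals
      simp only [Finset.mem_insert, Finset.mem_union, Finset.mem_image]
    · exact .inr (.inr (.inl ⟨z, hz, rfl⟩))
    · exact .inr (.inr (.inr ⟨z, hz, rfl⟩))
    · exact .inr (.inr (.inl ⟨z, hz, rfl⟩))
    · exact .inr (.inr (.inr ⟨z, hz, rfl⟩))
  rw [Finset.sum_congr rfl hz]
  simp only [Finset.sum_filter]
  rw [Finset.sum_comm]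
  refine Finset.sum_le_sum fun i hi => ?_
  split_ifs with hp
  · obtain ⟨z, hz, hp'⟩ := Set.mem_iUnion₂.1 (hcov hp)
    refine le_trans (le_of_eq (if_pos hp').symm) (Finset.single_le_sum
      (f := fun z => if p i ∈ Set.Icc (a' z) (b' z) ×ˢ Set.Icc (c' z) (d' z) then w i else 0)
      (fun z _ => ?_) hz)
    split_ifs
    exacts [hw i hi, le_rfl]
  · refine Finset.sum_nonneg fun z _ => ?_
    split_ifs
    exacts [hw i hi, le_rfl]

/-- Every q-tame persistence module has a persistence diagram. -/
theorem IsQTame.isDiagram_multiplicity (hV : V.IsQTame) : V.IsDiagram V.multiplicity where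
  qtame := hV
  lt_of_ne_zero z hz := by
    by_contra h
    exact hz (if_neg h)
  finite a b c d _ hbc _ := finite_support_multiplicity hV hbc
  card_interior_le a b c d hab hbc hcd := by
    have hf : (interior (Set.Icc a b ×ˢ Set.Icc c d) ∩ Function.support V.multiplicity).Finite :=
      (finite_support_multiplicity hV hbc).subset fun z hz => ⟨hz.2, interior_subset hz.1⟩
    rw [finsum_mem_eq_sum _ hf]
    exact sum_multiplicity_le hV hab hbc hcd _ fun z hz => (hf.mem_toFinset.1 hz).1
  le_card a b c d hab hbc hcd := by
    have hf : (Set.Icc a b ×ˢ Set.Icc c d ∩ Function.support V.multiplicity).Finite :=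
      (finite_support_multiplicity hV hbc).subset fun z hz => ⟨hz.2, hz.1⟩
    obtain ⟨Z, hZ, hle⟩ := measure_le_sum_multiplicity hV hab hbc hcd
    refine hle.trans (Nat.cast_le.2 ?_)
    rw [finsum_mem_eq_sum _ hf]
    refine Finset.sum_le_sum_of_ne_zero fun z hz h0 => hf.mem_toFinset.2 ⟨hZ z hz, h0⟩

theorem IsQTame.isDiagram_diagram (hV : V.IsQTame) : V.IsDiagram V.diagram := by
  have h : ∃ D, V.IsDiagram D := ⟨_, hV.isDiagram_multiplicity⟩
  rw [diagram, dif_pos h]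
  exact h.choose_spec

/-- A point is in the diagram if there are arbitrarily small rectangles of positive measure close
to the point. -/
theorem IsDiagram.ne_zero_of_forall_nhds {D : EReal × EReal → ℕ} (hD : V.IsDiagram D)
    {z : EReal × EReal} (hz : z.1 < z.2)
    (h : ∀ U ∈ 𝓝 z, ∃ a b c d, a < b ∧ b < c ∧ c < d ∧ Set.Icc a b ×ˢ Set.Icc c d ⊆ U ∧
      0 < V.measure a b c d) : D z ≠ 0 := by
  intro h0
  obtain ⟨a, b, c, d, h1, h2, h3, h4, -⟩ :=
    EReal.exists_rectangle_mem_nhds_subset hz Filter.univ_mem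
  have hfin := hD.finite a b c d h1 h2 h3
  -- If z is not a point of D, a small rectangle near z avoids the finitely many points of D, so its
  -- measure cannot be positive.
  obtain ⟨a', b', c', d', h1', h2', h3', h5, h6⟩ := h _ (Filter.inter_mem h4
    (hfin.isClosed.isOpen_compl.mem_nhds (fun hmem => hmem.1 h0)))
  have := hD.le_card a' b' c' d' h1' h2' h3'
  rw [finsum_mem_eq_zero_of_forall_eq_zero] at this
  · simp at this
    omega
  · intro w hw
    by_contra hne
    exact (h5 hw).2 ⟨hne, (h5 hw).1⟩

end PersistenceModule

/-! ### Topology of the Möbius band -/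

namespace ExpTwoCircle

theorem isOpenQuotientMap_mk :
    IsOpenQuotientMap (fun z : UnitAddCircle × UnitAddCircle => (s(z.1, z.2) : ExpTwoCircle)) where
  surjective w := by
    induction w with
    | h x y => exact ⟨(x, y), rfl⟩
  continuous := continuous_coinduced_rng
  isOpenMap U hU := by
    change IsOpen ((fun z : UnitAddCircle × UnitAddCircle => (s(z.1, z.2) : ExpTwoCircle)) ⁻¹' _)
    have : (fun z : UnitAddCircle × UnitAddCircle => (s(z.1, z.2) : ExpTwoCircle)) ⁻¹'
        ((fun z : UnitAddCircle × UnitAddCircle => (s(z.1, z.2) : ExpTwoCircle)) '' U) =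
        U ∪ Prod.swap ⁻¹' U := by
      ext ⟨x, y⟩
      constructor
      · rintro ⟨⟨a, b⟩, h, he⟩
        rcases Sym2.eq_iff.1 he with ⟨rfl, rfl⟩ | ⟨rfl, rfl⟩
        · exact .inl h
        · exact .inr h
      · rintro (h | h)
        · exact ⟨_, h, rfl⟩
        · exact ⟨_, h, Sym2.eq_swap⟩
    rw [this]
    exact hU.union (hU.preimage continuous_swap)

instance : CompactSpace ExpTwoCircle :=
  isOpenQuotientMap_mk.surjective.compactSpace isOpenQuotientMap_mk.continuous

instance : T2Space ExpTwoCircle := by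
  rw [t2Space_iff_of_isOpenQuotientMap isOpenQuotientMap_mk]
  have : {q : (UnitAddCircle × UnitAddCircle) × UnitAddCircle × UnitAddCircle |
      (s(q.1.1, q.1.2) : ExpTwoCircle) = s(q.2.1, q.2.2)} =
      {q | q.1.1 = q.2.1 ∧ q.1.2 = q.2.2} ∪ {q | q.1.1 = q.2.2 ∧ q.1.2 = q.2.1} := by
    ext q
    exact Sym2.eq_iff
  change IsClosed {q : (UnitAddCircle × UnitAddCircle) × UnitAddCircle × UnitAddCircle |
      (s(q.1.1, q.1.2) : ExpTwoCircle) = s(q.2.1, q.2.2)}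
  rw [this]
  refine IsClosed.union ?_ ?_
  · exact (isClosed_eq (by fun_prop) (by fun_prop)).inter (isClosed_eq (by fun_prop) (by fun_prop))
  · exact (isClosed_eq (by fun_prop) (by fun_prop)).inter (isClosed_eq (by fun_prop) (by fun_prop))

theorem isOpenQuotientMap_proj : IsOpenQuotientMap proj := by
  have h : IsOpenQuotientMap ((↑) : ℝ → UnitAddCircle) := QuotientAddGroup.isOpenQuotientMap_mk
  exact isOpenQuotientMap_mk.comp (h.prodMap h)

theorem continuous_proj : Continuous proj := isOpenQuotientMap_proj.continuous

instance : LocallyPathConnectedSpace ExpTwoCircle :=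
  isOpenQuotientMap_proj.isQuotientMap.locallyPathConnectedSpace

/-- A continuous function on `Exp₂(S¹)` is the same as a continuous symmetric function. -/
theorem continuous_iff {Z : Type*} [TopologicalSpace Z] {f : ExpTwoCircle → Z} :
    Continuous f ↔ Continuous fun z : UnitAddCircle × UnitAddCircle => f s(z.1, z.2) :=
  isOpenQuotientMap_mk.isQuotientMap.continuous_iff

/-- The sum of the elements. -/
noncomputable def sum : C(ExpTwoCircle, UnitAddCircle) :=
  ⟨Sym2.lift ⟨fun x y => x + y, add_comm⟩, continuous_iff.2 (by
    change Continuous fun z : UnitAddCircle × UnitAddCircle => z.1 + z.2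
    fun_prop)⟩

/-- The distance of the elements from a given point, where it is the same. -/
noncomputable def radius (m : UnitAddCircle) : ExpTwoCircle → ℝ :=
  Sym2.lift ⟨fun x y => max ‖x - m‖ ‖y - m‖, fun _ _ => max_comm _ _⟩

/-- The norm is the distance of a representative to the nearest integer. -/
theorem _root_.UnitAddCircle.coe_norm_eq_or (x : UnitAddCircle) :
    ((‖x‖ : ℝ) : UnitAddCircle) = x ∨ ((‖x‖ : ℝ) : UnitAddCircle) = -x := by
  induction x using QuotientAddGroup.induction_on with
  | H x =>
    have h : ((x - round x : ℝ) : UnitAddCircle) = x := by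
      simp
    change ((‖(x : UnitAddCircle)‖ : ℝ) : UnitAddCircle) = (x : UnitAddCircle) ∨
      ((‖(x : UnitAddCircle)‖ : ℝ) : UnitAddCircle) = -(x : UnitAddCircle)
    rw [UnitAddCircle.norm_eq]
    rcases abs_choice (x - round x) with h' | h'
    · left; rw [h', h]
    · right; rw [h', AddCircle.coe_neg, h]

theorem continuous_radius : Continuous fun q : UnitAddCircle × ExpTwoCircle => radius q.1 q.2 := by
  have hq := (IsOpenQuotientMap.id (X := UnitAddCircle)).prodMap isOpenQuotientMap_mk
  rw [hq.isQuotientMap.continuous_iff]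
  change Continuous fun q : UnitAddCircle × UnitAddCircle × UnitAddCircle =>
    max ‖q.2.1 - q.1‖ ‖q.2.2 - q.1‖
  fun_prop

/-- If 2m is the sum of the elements, they are exchanged by reflection in m, hence equally far from
m. -/
theorem proj_radius {m : ℝ} {u : ExpTwoCircle}
    (h : (m : UnitAddCircle) + (m : UnitAddCircle) = sum u) :
    proj (m - radius m u, m + radius m u) = u := by
  obtain ⟨⟨x, y⟩, rfl⟩ := isOpenQuotientMap_mk.surjective u
  change (s(((m - radius m s(x, y) : ℝ) : UnitAddCircle),
    ((m + radius m s(x, y) : ℝ) : UnitAddCircle)) : ExpTwoCircle) = s(x, y)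
  replace h : (m : UnitAddCircle) + (m : UnitAddCircle) = x + y := h
  rw [AddCircle.coe_sub, AddCircle.coe_add]
  generalize (m : UnitAddCircle) = m at h ⊢
  obtain rfl : y = m - (x - m) := by
    rw [eq_sub_iff_add_eq, eq_sub_of_add_eq' h.symm]; abel
  have hr : radius m s(x, m - (x - m)) = ‖x - m‖ := by
    change max ‖x - m‖ ‖m - (x - m) - m‖ = _
    rw [sub_sub_cancel_left, norm_neg, max_self]
  rw [hr]
  rcases UnitAddCircle.coe_norm_eq_or (x - m) with h | h
  · rw [h, Sym2.eq_swap]; simp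
  · rw [h, sub_neg_eq_add, ← sub_eq_add_neg]; simp

/-- Local contractibility, in terms of charts with convex images. -/
theorem exists_chart (w : ExpTwoCircle) {O : Set ExpTwoCircle} (hO : O ∈ 𝓝 w) :
    ∃ (U : Set ExpTwoCircle) (φ : ExpTwoCircle → ℝ × ℝ) (ψ : C(ℝ × ℝ, ExpTwoCircle)),
      IsOpen U ∧ w ∈ U ∧ ContinuousOn φ U ∧ (∀ u ∈ U, ψ (φ u) = u) ∧
      ∀ u ∈ U, ∀ t ∈ Set.Icc (0 : ℝ) 1, ψ ((1 - t) • φ w + t • φ u) ∈ O := by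
  obtain ⟨c, hc⟩ := QuotientAddGroup.mk_surjective (sum w)
  obtain ⟨e, he, hec⟩ := AddCircle.isLocalHomeomorph_coe (1 : ℝ) c
  have htgt : sum w ∈ e.target := by
    rw [← hc]; have := e.map_source he; rwa [← hec] at this
  -- Half of a local lift of the sum is a local midpoint; midpoint and radius recover the set. As ψ
  -- also accepts negative radii, boundary points need no separate treatment.
  obtain ⟨m, hm⟩ : ∃ m : ExpTwoCircle → ℝ, m = fun u => e.symm (sum u) / 2 := ⟨_, rfl⟩
  obtain ⟨φ, hφ⟩ : ∃ φ : ExpTwoCircle → ℝ × ℝ, φ = fun u => (m u, radius (m u) u) := ⟨_, rfl⟩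
  let ψ : C(ℝ × ℝ, ExpTwoCircle) := ⟨fun z => proj (z.1 - z.2, z.1 + z.2), by
    have := continuous_proj; fun_prop⟩
  have hU₀ : IsOpen (sum ⁻¹' e.target) := e.open_target.preimage sum.continuous
  have hmc : ContinuousOn m (sum ⁻¹' e.target) := by
    rw [hm]
    exact (e.continuousOn_symm.comp sum.continuous.continuousOn fun u hu => hu).div_const 2
  have hφc : ContinuousOn φ (sum ⁻¹' e.target) := by
    have h2 : Continuous ((↑) : ℝ → UnitAddCircle) := AddCircle.continuous_mk' 1
    have h3 : ContinuousOn (fun u => ((m u : UnitAddCircle), u)) (sum ⁻¹' e.target) :=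
      (h2.comp_continuousOn hmc).prodMk continuousOn_id
    rw [hφ]
    have h4 := continuous_radius.comp_continuousOn h3
    exact hmc.prodMk h4
  have hψφ : ∀ u ∈ sum ⁻¹' e.target, ψ (φ u) = u := by
    intro u hu
    have hs : ((e.symm (sum u) : ℝ) : UnitAddCircle) = sum u := by
      have := e.right_inv hu
      rwa [← hec] at this
    have h2m : (m u : UnitAddCircle) + (m u : UnitAddCircle) = sum u := by
      rw [hm, ← AddCircle.coe_add, add_halves, hs]
    rw [hφ]
    exact proj_radius h2m
  have hV : ψ ⁻¹' O ∈ 𝓝 (φ w) := by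
    apply ψ.continuous.continuousAt.preimage_mem_nhds
    rwa [hψφ w htgt]
  obtain ⟨r, hr, hball⟩ := Metric.mem_nhds_iff.1 hV
  refine ⟨sum ⁻¹' e.target ∩ φ ⁻¹' Metric.ball (φ w) r, φ, ψ,
    hφc.isOpen_inter_preimage hU₀ Metric.isOpen_ball, ⟨htgt, Metric.mem_ball_self hr⟩,
    hφc.mono Set.inter_subset_left, fun u hu => hψφ u hu.1, fun u hu t ht => ?_⟩
  exact hball ((convex_ball (φ w) r) (Metric.mem_ball_self hr) hu.2 (by linarith [ht.2]) ht.1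
    (by ring))

/-- The fundamental triangle `s ≤ x ≤ y ≤ s + 1`. -/
def triangle (s : ℝ) : Set (ℝ × ℝ) := {z | s ≤ z.1 ∧ z.1 ≤ z.2 ∧ z.2 ≤ s + 1}

theorem isCompact_triangle (s : ℝ) : IsCompact (triangle s) := by
  have hc : IsClosed (triangle s) :=
    (isClosed_le continuous_const continuous_fst).inter
      ((isClosed_le continuous_fst continuous_snd).inter
        (isClosed_le continuous_snd continuous_const))
  have hK : IsCompact (Set.Icc s (s + 1) ×ˢ Set.Icc s (s + 1)) := isCompact_Icc.prod isCompact_Icc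
  exact hK.of_isClosed_subset hc fun z hz =>
    ⟨⟨hz.1, hz.2.1.trans hz.2.2⟩, hz.1.trans hz.2.1, hz.2.2⟩

theorem exists_mem_triangle (s : ℝ) (w : ExpTwoCircle) : ∃ z ∈ triangle s, proj z = w := by
  obtain ⟨⟨a, b⟩, rfl⟩ := isOpenQuotientMap_mk.surjective w
  obtain ⟨x, hx, rfl⟩ : ∃ x ∈ Set.Ico s (s + 1), (x : UnitAddCircle) = a :=
    ⟨_, (AddCircle.equivIco 1 s a).2, AddCircle.coe_equivIco⟩
  obtain ⟨y, hy, rfl⟩ : ∃ x ∈ Set.Ico s (s + 1), (x : UnitAddCircle) = b :=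
    ⟨_, (AddCircle.equivIco 1 s b).2, AddCircle.coe_equivIco⟩
  rcases le_total x y with h | h
  · exact ⟨(x, y), ⟨hx.1, h, hy.2.le⟩, rfl⟩
  · exact ⟨(y, x), ⟨hy.1, h, hx.2.le⟩, Sym2.eq_swap⟩

/-- A continuous surjection from a compact space to a Hausdorff space is a quotient map. -/
theorem isQuotientMap_triangle (s : ℝ) : IsQuotientMap fun z : triangle s => proj z := by
  have := isCompact_iff_compactSpace.1 (isCompact_triangle s)
  have hc : Continuous fun z : triangle s => proj z := continuous_proj.comp continuous_subtype_val
  exact IsQuotientMap.of_surjective_continuous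
    (fun w => by obtain ⟨z, hz, h⟩ := exists_mem_triangle s w; exact ⟨⟨z, hz⟩, h⟩) hc

theorem continuous_of_continuousOn_strip {Z : Type*} [TopologicalSpace Z] {g : ExpTwoCircle → Z}
    (h : ContinuousOn (g ∘ proj) strip) : Continuous g := by
  rw [(isQuotientMap_triangle 0).continuous_iff]
  refine h.comp_continuous continuous_subtype_val fun z => ?_
  obtain ⟨h1, h2, h3⟩ := z.2
  exact ⟨h2, by linarith⟩

end ExpTwoCircle

/-! ### The circle-valued map on the complement of an interior point -/

namespace ExpTwoCircle

theorem coe_eq_coe_iff_of_mem_Icc {s x y : ℝ} (hx : x ∈ Set.Icc s (s + 1))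
    (hy : y ∈ Set.Icc s (s + 1)) : (x : UnitAddCircle) = y ↔
      x = y ∨ (x = s ∧ y = s + 1) ∨ (x = s + 1 ∧ y = s) := by
  constructor
  · intro h
    obtain ⟨k, hk⟩ := QuotientAddGroup.eq.1 h
    simp only [mul_one, zsmul_eq_mul] at hk
    have h1 : (k : ℝ) < 2 := by linarith [hx.1, hy.2]
    have h2 : (-2 : ℝ) < k := by linarith [hx.2, hy.1]
    have h1' : k < 2 := by exact_mod_cast h1
    have h2' : -2 < k := by exact_mod_cast h2
    obtain rfl | rfl | rfl : k = -1 ∨ k = 0 ∨ k = 1 := by omega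
    · right; right; push_cast at hk; constructor <;> linarith [hx.1, hx.2, hy.1, hy.2]
    · left; push_cast at hk; linarith
    · right; left; push_cast at hk; constructor <;> linarith [hx.1, hx.2, hy.1, hy.2]
  · rintro (rfl | ⟨rfl, rfl⟩ | ⟨rfl, rfl⟩) <;> simp

/-- Two points of the fundamental triangle which are glued are equal or on the two short sides. -/
theorem eq_or_mem_sides_of_proj_eq {s : ℝ} {z w : ℝ × ℝ} (hz : z ∈ triangle s)
    (hw : w ∈ triangle s) (h : proj z = proj w) :
    z = w ∨ ((z.1 = s ∨ z.2 = s + 1) ∧ (w.1 = s ∨ w.2 = s + 1)) := by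
  obtain ⟨x, y⟩ := z
  obtain ⟨x', y'⟩ := w
  obtain ⟨h1, h2, h3⟩ := hz
  obtain ⟨h1', h2', h3'⟩ := hw
  simp only at h1 h2 h3 h1' h2' h3' ⊢
  have hx : x ∈ Set.Icc s (s + 1) := ⟨h1, h2.trans h3⟩
  have hy : y ∈ Set.Icc s (s + 1) := ⟨h1.trans h2, h3⟩
  have hx' : x' ∈ Set.Icc s (s + 1) := ⟨h1', h2'.trans h3'⟩
  have hy' : y' ∈ Set.Icc s (s + 1) := ⟨h1'.trans h2', h3'⟩
  rw [Prod.mk.injEq]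
  rcases Sym2.eq_iff.1 h with ⟨e1, e2⟩ | ⟨e1, e2⟩
  · rw [coe_eq_coe_iff_of_mem_Icc hx hx'] at e1
    rw [coe_eq_coe_iff_of_mem_Icc hy hy'] at e2
    grind
  · rw [coe_eq_coe_iff_of_mem_Icc hx hy'] at e1
    rw [coe_eq_coe_iff_of_mem_Icc hy hx'] at e2
    grind

/-- The angular coordinate around the point `c`, which is constant on the short sides of a
fundamental triangle around `c`. -/
noncomputable def slit (c z : ℝ × ℝ) : ℝ :=
  max (z.1 - c.1) 0 / (max (z.1 - c.1) 0 + max (c.2 - z.2) 0)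

theorem coe_slit_eq_zero {c z : ℝ × ℝ} (h : z.1 ≤ c.1 ∨ c.2 ≤ z.2) :
    (slit c z : UnitAddCircle) = 0 := by
  unfold slit
  rcases h with h | h
  · rw [max_eq_right (sub_nonpos.2 h), zero_div, AddCircle.coe_zero]
  · rw [max_eq_right (sub_nonpos.2 h), add_zero]
    rcases eq_or_ne (max (z.1 - c.1) 0) 0 with h0 | h0
    · rw [h0, zero_div, AddCircle.coe_zero]
    · rw [div_self h0, AddCircle.coe_period]

/-- Where z.1 < c.1 or c.2 < z.2, the value modulo 1 is locally constant. In the remaining closed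
quadrant the denominator vanishes only at c. -/
theorem continuousAt_coe_slit {c z : ℝ × ℝ} (h : z ≠ c) :
    ContinuousAt (fun z => (slit c z : UnitAddCircle)) z := by
  have hzero : (z.1 < c.1 ∨ c.2 < z.2) → ContinuousAt (fun z => (slit c z : UnitAddCircle)) z := by
    intro h
    have ho : IsOpen {z : ℝ × ℝ | z.1 < c.1 ∨ c.2 < z.2} :=
      (isOpen_lt continuous_fst continuous_const).union (isOpen_lt continuous_const continuous_snd)
    refine (continuousAt_const (y := (0 : UnitAddCircle))).congr ?_
    filter_upwards [ho.mem_nhds h] with w hw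
    exact (coe_slit_eq_zero (hw.imp le_of_lt le_of_lt)).symm
  by_cases h' : z.1 < c.1 ∨ c.2 < z.2
  · exact hzero h'
  push Not at h'
  have hne : max (z.1 - c.1) 0 + max (c.2 - z.2) 0 ≠ 0 := by
    intro h0
    rw [max_eq_left (sub_nonneg.2 h'.1), max_eq_left (sub_nonneg.2 h'.2)] at h0
    exact h (Prod.ext (by linarith [h'.1, h'.2]) (by linarith [h'.1, h'.2]))
  have h1 : ContinuousAt (slit c) z := by
    unfold slit
    refine ContinuousAt.div (by fun_prop) (by fun_prop) hne
  exact (AddCircle.continuous_mk' 1).continuousAt.comp h1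

/-- The map from the complement of an interior point of the fundamental triangle to the circle. -/
theorem exists_slit_map {s : ℝ} {c : ℝ × ℝ} (h1 : s < c.1) (h2 : c.1 < c.2) (h3 : c.2 < s + 1) :
    ∃ f : ExpTwoCircle → UnitAddCircle, ContinuousOn f {proj c}ᶜ ∧
      ∀ z ∈ triangle s, f (proj z) = slit c z := by
  choose r hr hr' using exists_mem_triangle s
  have hf : ∀ z ∈ triangle s, (slit c (r (proj z)) : UnitAddCircle) = slit c z := by
    intro z hz
    -- Gluing only identifies points on the short sides, where the angle is 0 modulo 1, so the
    -- choice of representative does not matter.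
    rcases eq_or_mem_sides_of_proj_eq (hr (proj z)) hz (hr' _) with h | ⟨h, h'⟩
    · rw [h]
    · have key : ∀ w : ℝ × ℝ, (w.1 = s ∨ w.2 = s + 1) → (slit c w : UnitAddCircle) = 0 :=
        fun w hw => coe_slit_eq_zero (hw.imp (fun h => by rw [h]; exact h1.le) fun h => by rw [h]; exact h3.le)
      rw [key _ h, key _ h']
  refine ⟨fun w => slit c (r w), ?_, hf⟩
  have hq := (isQuotientMap_triangle s).restrictPreimage_isOpen
    (isOpen_compl_singleton (x := proj c))
  rw [continuousOn_iff_continuous_domRestrict, hq.continuous_iff, continuous_iff_continuousAt]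
  rintro ⟨⟨z, hz⟩, hzc⟩
  have hne : z ≠ c := by rintro rfl; exact hzc rfl
  have hcont : ContinuousAt (fun w : (fun z : triangle s => proj z) ⁻¹' {proj c}ᶜ =>
      (slit c (w.1.1) : UnitAddCircle)) ⟨⟨z, hz⟩, hzc⟩ :=
    ContinuousAt.comp (f := fun w : (fun z : triangle s => proj z) ⁻¹' {proj c}ᶜ => w.1.1)
      (continuousAt_coe_slit hne) (by fun_prop)
  refine hcont.congr (Filter.Eventually.of_forall fun w => ?_)
  exact (hf w.1.1 w.1.2).symm

end ExpTwoCircle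

/-! ### Finite rank from compactness and local contractibility -/

namespace SingularChain

variable (F : Type) [Field F] {X : Type} [TopologicalSpace X] {Y : Type} [TopologicalSpace Y]

/-- In `U`, every path is homologous to a chain which depends on its end points only. -/
def IsPathTrivial (U : Set Y) : Prop :=
  ∃ q : Y → (cpx F Y).X 1, ∀ (c : C(ℝ, Y)) (a b : ℝ), a ≤ b → (∀ s ∈ Set.Icc a b, c s ∈ U) →
    seg F c a b - (q (c b) - q (c a)) ∈ Boundaries F Y

theorem isPathTrivial_of_homotopy {U : Set Y} (K : ℝ → Y → Y) (y₀ : Y)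
    (hK : ContinuousOn (fun z : ℝ × Y => K z.1 z.2) (Set.Icc 0 1 ×ˢ U))
    (h0 : ∀ u ∈ U, K 0 u = y₀) (h1 : ∀ u ∈ U, K 1 u = u) : IsPathTrivial F U := by
  classical
  have hproj : Continuous fun t : ℝ => (Set.projIcc (0 : ℝ) 1 zero_le_one t : ℝ) :=
    continuous_subtype_val.comp continuous_projIcc
  have hpath : ∀ u ∈ U, Continuous fun t : ℝ => K (Set.projIcc (0 : ℝ) 1 zero_le_one t) u :=
    fun u hu => hK.comp_continuous (hproj.prodMk continuous_const) fun t =>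
      ⟨(Set.projIcc (0 : ℝ) 1 zero_le_one t).2, hu⟩
  -- The endpoint term is the track from y₀ to u under the contraction. The square swept out by the
  -- path has a constant bottom edge, the path on top and two tracks as sides.
  refine ⟨fun u => if hu : u ∈ U then seg F ⟨_, hpath u hu⟩ (0 : ℝ) 1 else 0,
    fun c a b hab hc => ?_⟩
  have ha : c a ∈ U := hc a ⟨le_rfl, hab⟩
  have hb : c b ∈ U := hc b ⟨hab, le_rfl⟩
  have hprojab : Continuous fun t : ℝ => (Set.projIcc a b hab t : ℝ) :=
    continuous_subtype_val.comp continuous_projIcc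
  let κ : C(ℝ × ℝ, Y) := ⟨fun z => K (Set.projIcc (0 : ℝ) 1 zero_le_one z.2)
    (c (Set.projIcc a b hab z.1)), hK.comp_continuous (f := fun z : ℝ × ℝ =>
      ((Set.projIcc (0 : ℝ) 1 zero_le_one z.2 : ℝ), c (Set.projIcc a b hab z.1)))
      (by fun_prop) fun z => ⟨(Set.projIcc (0 : ℝ) 1 zero_le_one z.2).2,
        hc _ (Set.projIcc a b hab z.1).2⟩⟩
  have hsq := seg_square F κ (a, 0) (b, 0) (a, 1) (b, 1)
  have e1 : seg F κ (a, 0) (b, 0) ∈ Boundaries F Y := by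
    refine seg_const F y₀ κ _ _ fun t ht => ?_
    simp only [κ, ContinuousMap.coe_mk]
    simp only [Prod.smul_mk, Prod.mk_add_mk, smul_zero, add_zero, Set.projIcc_left]
    exact h0 _ (hc _ (Subtype.mem _))
  have e2 : seg F κ (b, 0) (b, 1) = seg F ⟨_, hpath _ hb⟩ (0 : ℝ) 1 := by
    refine seg_congr F fun t ht => ?_
    simp only [κ, ContinuousMap.coe_mk, Prod.smul_mk, Prod.mk_add_mk]
    rw [← add_smul, sub_add_cancel, one_smul, Set.projIcc_right]
  have e3 : seg F κ (a, 0) (a, 1) = seg F ⟨_, hpath _ ha⟩ (0 : ℝ) 1 := by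
    refine seg_congr F fun t ht => ?_
    simp only [κ, ContinuousMap.coe_mk, Prod.smul_mk, Prod.mk_add_mk]
    rw [← add_smul, sub_add_cancel, one_smul, Set.projIcc_left]
  have e4 : seg F κ (a, 1) (b, 1) = seg F c a b := by
    refine seg_congr F fun t ht => ?_
    simp only [κ, ContinuousMap.coe_mk, Prod.smul_mk, Prod.mk_add_mk]
    rw [← add_smul, sub_add_cancel, one_smul, Set.projIcc_right]
    have hm : (1 - t) • a + t • b ∈ Set.Icc a b :=
      (convex_Icc a b) ⟨le_rfl, hab⟩ ⟨hab, le_rfl⟩ (by linarith [ht.2]) ht.1 (by ring)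
    rw [Set.projIcc_of_mem hab hm]
    exact h1 _ (hc _ hm)
  rw [e2, e3, e4] at hsq
  simp only [dif_pos ha, dif_pos hb]
  have := Submodule.sub_mem _ e1 hsq
  convert this using 1
  abel

/-- The image in homology of a compact space in a locally path-trivial space is
finite-dimensional. -/
theorem exists_finite_dimensional_of_isPathTrivial [CompactSpace X] [T3Space Y]
    [LocallyPathConnectedSpace Y] (hY : ∀ y : Y, ∃ U, IsOpen U ∧ y ∈ U ∧ IsPathTrivial F U)
    (f : C(X, Y)) : ∃ E : Submodule F ((cpx F Y).X 1 ⧸ Boundaries F Y), FiniteDimensional F E ∧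
      ∀ z ∈ Cycles F X, (Boundaries F Y).mkQ (push F 1 f z) ∈ E := by
  classical
  choose U hUo hyU q hq using hY
  set π := (Boundaries F Y).mkQ with hπ
  have hq' : ∀ (y : Y) (c : C(ℝ, Y)) (a b : ℝ), a ≤ b → (∀ s ∈ Set.Icc a b, c s ∈ U y) →
      π (seg F c a b) = π (q y (c b)) - π (q y (c a)) := by
    intro y c a b hab hc
    rw [← map_sub, hπ, Submodule.mkQ_apply, Submodule.mkQ_apply]
    exact (Submodule.Quotient.eq _).2 (hq y c a b hab hc)
  choose W hyW hWc hWU using fun y => exists_mem_nhds_isClosed_subset ((hUo y).mem_nhds (hyU y))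
  obtain ⟨T, -, hT⟩ := (isCompact_range f.continuous).elim_nhds_subcover
    (fun y => interior (W y)) fun y _ => interior_mem_nhds.2 (hyW y)
  -- A short path in the overlap of two patches is expressed by both q i and q j, so their
  -- difference is locally constant modulo boundaries. On a compact overlap it takes finitely many
  -- values.
  have hfin : ∀ i j, ((fun v => π (q i v) - π (q j v)) ''
      (Set.range f ∩ (W i ∩ W j))).Finite := by
    intro i j
    have hK : IsCompact (Set.range f ∩ (W i ∩ W j)) :=
      (isCompact_range f.continuous).inter_right ((hWc i).inter (hWc j))
    have hloc : ∀ v ∈ Set.range f ∩ (W i ∩ W j), ∃ N ∈ 𝓝 v,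
        ∀ u ∈ N, π (q i u) - π (q j u) = π (q i v) - π (q j v) := by
      rintro v ⟨-, hvi, hvj⟩
      have hO : U i ∩ U j ∈ 𝓝 v :=
        ((hUo i).inter (hUo j)).mem_nhds ⟨hWU i hvi, hWU j hvj⟩
      obtain ⟨N, ⟨hN, hNp⟩, hNO⟩ := (LocallyPathConnectedSpace.path_connected_basis v).mem_iff.1 hO
      refine ⟨N, hN, fun u hu => ?_⟩
      obtain ⟨γ, hγ⟩ := hNp.joinedIn v (mem_of_mem_nhds hN) u hu
      let c : C(ℝ, Y) := ⟨γ.extend, γ.continuous_extend⟩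
      have hc : ∀ s, c s ∈ U i ∩ U j := fun s => hNO (hγ _)
      have h1 := hq' i c 0 1 zero_le_one fun s _ => (hc s).1
      have h2 := hq' j c 0 1 zero_le_one fun s _ => (hc s).2
      have e0 : c 0 = v := γ.extend_zero
      have e1 : c 1 = u := γ.extend_one
      rw [e0, e1] at h1 h2
      have := h1.symm.trans h2
      rw [sub_eq_sub_iff_add_eq_add] at this ⊢
      rw [this]
      abel
    choose! N hN hNc using hloc
    obtain ⟨S, hSK, hS⟩ := hK.elim_nhds_subcover N hN
    refine (S.finite_toSet.image fun v => π (q i v) - π (q j v)).subset ?_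
    rintro _ ⟨u, hu, rfl⟩
    obtain ⟨v, hv, huv⟩ := Set.mem_iUnion₂.1 (hS hu)
    exact ⟨v, hv, (hNc v (hSK v hv) u huv).symm⟩
  let E : Submodule F ((cpx F Y).X 1 ⧸ Boundaries F Y) := Submodule.span F
    (⋃ i ∈ T, ⋃ j ∈ T, (fun v => π (q i v) - π (q j v)) '' (Set.range f ∩ (W i ∩ W j)))
  have hE : FiniteDimensional F E := FiniteDimensional.span_of_finite F
    (T.finite_toSet.biUnion fun i _ => T.finite_toSet.biUnion fun j _ => hfin i j)
  refine ⟨E, hE, fun z hz => ?_⟩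
  have hj : ∀ x : X, ∃ j ∈ T, f x ∈ interior (W j) := fun x => by
    simpa using hT (Set.mem_range_self x)
  choose j hjT hj using hj
  -- Subdivide the path so that each piece stays in one patch. Replacing the endpoint terms of that
  -- patch by the chosen ones costs only elements of E.
  refine push_mem_of_forall_seg F f (fun x => q (j x) (f x)) (E.comap π) (fun c => ?_) hz
  have hdiff : ∀ i ∈ T, ∀ x, f x ∈ W i → π (q i (f x)) - π (q (j x) (f x)) ∈ E := by
    intro i hi x hx
    refine Submodule.subset_span (Set.mem_iUnion₂.2 ⟨i, hi, Set.mem_iUnion₂.2 ⟨j x, hjT x, ?_⟩⟩)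
    exact ⟨f x, ⟨⟨x, rfl⟩, hx, interior_subset (hj x)⟩, rfl⟩
  obtain ⟨t, ht0, htm, ⟨n, hn⟩, hcov⟩ := exists_monotone_Icc_subset_open_cover_unitInterval
    (c := fun i : T => {s : unitInterval | f (c s) ∈ interior (W i)})
    (fun i => isOpen_interior.preimage (by fun_prop)) (fun s _ => by
      obtain ⟨i, hi, h⟩ := Set.mem_iUnion₂.1 (hT (Set.mem_range_self (c s)))
      exact Set.mem_iUnion.2 ⟨⟨i, hi⟩, h⟩)
  have key : ∀ m, π (seg F (f.comp c) 0 (t m : ℝ)) -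
      (π (q (j (c (t m))) (f (c (t m)))) - π (q (j (c 0)) (f (c 0)))) ∈ E := by
    intro m
    induction m with
    | zero =>
      have : π (seg F (f.comp c) (0 : ℝ) 0) = 0 :=
        (Submodule.Quotient.mk_eq_zero _).2 (seg_self F _ _)
      rw [ht0, Set.Icc.coe_zero, this]
      simp
    | succ m ih =>
      obtain ⟨⟨i, hi⟩, hmi⟩ := hcov m
      have hle : (t m : ℝ) ≤ t (m + 1) := htm m.le_succ
      have hW : ∀ s ∈ Set.Icc (t m : ℝ) (t (m + 1)), f (c s) ∈ W i := fun s hs => by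
        have hs' : s ∈ Set.Icc (0 : ℝ) 1 := ⟨(t m).2.1.trans hs.1, hs.2.trans (t (m + 1)).2.2⟩
        exact interior_subset (hmi (show (⟨s, hs'⟩ : unitInterval) ∈ Set.Icc (t m) (t (m + 1))
          from hs))
      have h1 := hq' i (f.comp c) (t m) (t (m + 1)) hle fun s hs => hWU i (hW s hs)
      have h2 : π (seg F (f.comp c) 0 (t m : ℝ)) + π (seg F (f.comp c) (t m : ℝ) (t (m + 1))) -
          π (seg F (f.comp c) 0 (t (m + 1) : ℝ)) = 0 := by
        rw [← map_add, ← map_sub]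
        exact (Submodule.Quotient.mk_eq_zero _).2 (seg_triangle F _ _ _ _)
      have h3 := hdiff i hi (c (t m)) (hW _ ⟨le_rfl, hle⟩)
      have h4 := hdiff i hi (c (t (m + 1))) (hW _ ⟨hle, le_rfl⟩)
      rw [h1] at h2
      have h5 := E.add_mem ih (E.sub_mem h4 h3)
      convert h5 using 1
      rw [← sub_eq_zero.1 h2]
      simp only [ContinuousMap.comp_apply]
      abel
  have := key n
  rw [hn n le_rfl] at this
  simpa [Submodule.mem_comap] using this

theorem finiteDimensional_range_of_ker_le {K A B C : Type*} [Field K] [AddCommGroup A] [Module K A]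
    [AddCommGroup B] [Module K B] [AddCommGroup C] [Module K C] (θ : A →ₗ[K] B) (ρ : A →ₗ[K] C)
    [FiniteDimensional K (LinearMap.range θ)] (h : LinearMap.ker θ ≤ LinearMap.ker ρ) :
    FiniteDimensional K (LinearMap.range ρ) := by
  have : FiniteDimensional K (A ⧸ LinearMap.ker θ) :=
    Module.Finite.equiv θ.quotKerEquivRange.symm
  rw [← Submodule.range_liftQ _ ρ h]
  infer_instance

end SingularChain

/-! ### Q-tameness and homology relations on the Möbius band -/

open SingularChain ExpTwoCircle

theorem sublevelHomology_map_cls_eq_zero_iff (F : Type) [Field F] {X : Type} [TopologicalSpace X]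
    (g : X → ℝ) {s t : ℝ} (h : s ≤ t) (z : Cycles F {x // g x ≤ s}) :
    ((sublevelHomology F 1 g).map (homOfLE h)).hom (cls F z) = 0 ↔
      push F 1 (sublevelIncl g h) z ∈ Boundaries F {x // g x ≤ t} :=
  ⟨fun h0 => (cls_eq_zero_iff F _).1 ((sublevelHomology_map_cls F g h z).symm.trans h0),
    fun h0 => (sublevelHomology_map_cls F g h z).trans
      ((cls_eq_zero_iff F ⟨push F 1 (sublevelIncl g h) z, push_mem_cycles F _ z.2⟩).2 h0)⟩

namespace ExpTwoCircle

variable (F : Type) [Field F]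

theorem isPathTrivial_of_isOpen {O : Set ExpTwoCircle} (hO : IsOpen O) (y : O) :
    ∃ U : Set O, IsOpen U ∧ y ∈ U ∧ IsPathTrivial F U := by
  classical
  obtain ⟨U, φ, ψ, hU, hyU, hφ, hψφ, hin⟩ := exists_chart y.1 (hO.mem_nhds y.2)
  refine ⟨Subtype.val ⁻¹' U, hU.preimage continuous_subtype_val, hyU, ?_⟩
  let k : ℝ → O → ExpTwoCircle := fun t u => ψ ((1 - t) • φ y + t • φ u)
  have hk : ∀ z ∈ Set.Icc (0 : ℝ) 1 ×ˢ (Subtype.val ⁻¹' U : Set O), k z.1 z.2 ∈ O :=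
    fun z hz => hin _ hz.2 _ hz.1
  refine isPathTrivial_of_homotopy F (fun t u => if h : k t u ∈ O then ⟨k t u, h⟩ else y) y
    ?_ ?_ ?_
  · rw [Topology.IsInducing.subtypeVal.continuousOn_iff]
    have hc : ContinuousOn (fun z : ℝ × O => k z.1 z.2)
        (Set.Icc (0 : ℝ) 1 ×ˢ (Subtype.val ⁻¹' U : Set O)) := by
      have h1 : ContinuousOn (fun z : ℝ × O => φ z.2)
          (Set.Icc (0 : ℝ) 1 ×ˢ (Subtype.val ⁻¹' U : Set O)) :=
        hφ.comp (f := fun z : ℝ × O => (z.2 : ExpTwoCircle)) (by fun_prop) fun z hz => hz.2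
      refine ψ.continuous.comp_continuousOn ?_
      exact ((continuousOn_const.sub continuousOn_fst).smul continuousOn_const).add
        (continuousOn_fst.smul h1)
    refine hc.congr fun z hz => ?_
    simp only [Function.comp_apply, dif_pos (hk z hz)]
  · intro u hu
    have h := hk (0, u) ⟨by simp, hu⟩
    rw [dif_pos h]
    apply Subtype.ext
    simp [k, hψφ _ hyU]
  · intro u hu
    have h := hk (1, u) ⟨by simp, hu⟩
    rw [dif_pos h]
    apply Subtype.ext
    simp [k, hψφ _ hu]

/-- The inclusion factors through the open set where g < t. That set is locally contractible,
whereas closed sublevel sets of a continuous g need not be. -/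
theorem isQTame_sublevelHomology {g : ExpTwoCircle → ℝ} (hg : Continuous g) :
    (sublevelHomology F 1 g).IsQTame := by
  intro s t hst
  have hO : IsOpen {w | g w < t} := isOpen_lt hg continuous_const
  have : LocallyPathConnectedSpace {w | g w < t} := hO.locallyPathConnectedSpace
  have : CompactSpace {w // g w ≤ s} :=
    isCompact_iff_compactSpace.1 (isClosed_le hg continuous_const).isCompact
  let f : C({w // g w ≤ s}, {w | g w < t}) := ⟨fun w => ⟨w.1, w.2.trans_lt hst⟩, by fun_prop⟩
  let i : C({w | g w < t}, {w // g w ≤ t}) := ⟨fun w => ⟨w.1, w.2.le⟩, by fun_prop⟩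
  obtain ⟨E, hE, hfE⟩ := exists_finite_dimensional_of_isPathTrivial F
    (isPathTrivial_of_isOpen F hO) f
  let θ : Cycles F {w // g w ≤ s} →ₗ[F] _ :=
    (Boundaries F {w | g w < t}).mkQ ∘ₗ push F 1 f ∘ₗ (Cycles F {w // g w ≤ s}).subtype
  let ρ : Cycles F {w // g w ≤ s} →ₗ[F] _ :=
    ((sublevelHomology F 1 g).map (homOfLE hst.le)).hom ∘ₗ cls F
  have hρ : LinearMap.range ρ =
      LinearMap.range ((sublevelHomology F 1 g).map (homOfLE hst.le)).hom :=
    LinearMap.range_comp_of_range_eq_top _ (LinearMap.range_eq_top.2 (cls_surjective F))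
  rw [← hρ]
  have : FiniteDimensional F (LinearMap.range θ) := by
    refine Submodule.finiteDimensional_of_le (S₂ := E) ?_
    rintro _ ⟨z, rfl⟩
    exact hfE z z.2
  refine finiteDimensional_range_of_ker_le θ ρ fun z hz => ?_
  have h1 : push F 1 f z ∈ Boundaries F {w | g w < t} := by
    rw [LinearMap.mem_ker] at hz
    exact (Submodule.Quotient.mk_eq_zero _).1 hz
  have h2 := push_mem_boundaries F i h1
  rw [LinearMap.mem_ker]
  change ((sublevelHomology F 1 g).map (homOfLE hst.le)).hom (cls F z) = 0
  rw [sublevelHomology_map_cls_eq_zero_iff]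
  have h3 : push F 1 i ∘ₗ push F 1 f = push F 1 (sublevelIncl g hst.le) := hom_ext F fun σ => by
    rw [LinearMap.comp_apply, push_single, push_single, push_single]
    rfl
  rw [← h3]
  exact h2

variable {X : Type} [TopologicalSpace X]

/-- The winding number around an interior point of a Möbius band. -/
theorem exists_winding_slit {w₀ : ExpTwoCircle} (hw₀ : w₀ ∉ boundary) {s : ℝ}
    (hs : ∀ t : ℝ, proj (s, t) ≠ w₀) (j : C(X, ExpTwoCircle)) (hj : ∀ x, j x ≠ w₀) :
    ∃ W : (cpx F X).X 1 →ₗ[F] F, (∀ z ∈ Boundaries F X, W z = 0) ∧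
      (∀ c : C(ℝ, X), (∀ t, j (c t) = proj (s + t, s + t)) → W (seg F c 0 1) = 1) ∧
      (∀ c : C(ℝ, X), (∀ t, j (c t) = proj (s, s + t)) → W (seg F c 0 1) = 0) := by
  obtain ⟨c, hc, rfl⟩ := exists_mem_triangle s w₀
  obtain ⟨h1, h2, h3⟩ := hc
  -- The fiber over s avoids w₀, which keeps c off the short sides; w₀ is not a boundary point,
  -- which keeps c off the hypotenuse.
  have h1' : s < c.1 := lt_of_le_of_ne h1 fun h => hs c.2 (by rw [h])
  have h2' : c.1 < c.2 := lt_of_le_of_ne h2 fun h => hw₀ (by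
    change Sym2.IsDiag s(_, _)
    rw [Sym2.mk_isDiag_iff, h])
  have h3' : c.2 < s + 1 := lt_of_le_of_ne h3 fun h => hs c.1 (by
    have : proj c = s((c.1 : UnitAddCircle), ((s + 1 : ℝ) : UnitAddCircle)) := by rw [← h]; rfl
    rw [this, AddCircle.coe_add_period, Sym2.eq_swap]
    rfl)
  obtain ⟨f, hf, hft⟩ := exists_slit_map h1' h2' h3'
  obtain ⟨W, hW, hWc⟩ := exists_winding F (X := X)
    ⟨fun x => f (j x), hf.comp_continuous j.continuous hj⟩
  refine ⟨W, hW, fun γ hγ => ?_, fun γ hγ => ?_⟩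
  · have hpos : ∀ t : ℝ, 0 < max (s + t - c.1) 0 + max (c.2 - (s + t)) 0 := fun t => by
      have := le_max_left (s + t - c.1) 0
      have := le_max_left (c.2 - (s + t)) 0
      linarith
    have hcont : Continuous fun t : ℝ => slit c (s + t, s + t) := by
      unfold slit
      exact Continuous.div (by fun_prop) (by fun_prop) fun t => (hpos t).ne'
    rw [hWc γ ⟨_, hcont⟩ fun t ht => ?_]
    · have e0 : slit c (s + 0, s + 0) = 0 := by
        simp [slit, max_eq_right (sub_nonpos.2 h1)]
      have e1 : slit c (s + 1, s + 1) = 1 := by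
        have : (0 : ℝ) < s + 1 - c.1 := by linarith
        simp [slit, max_eq_right (sub_nonpos.2 h3), max_eq_left this.le, this.ne']
      simp only [ContinuousMap.coe_mk, e0, e1]
      simp
    · simp only [ContinuousMap.coe_mk, hγ]
      exact (hft _ ⟨by simpa using ht.1, le_rfl, by simpa using ht.2⟩).symm
  · rw [hWc γ (ContinuousMap.const _ 0) fun t ht => ?_]
    · simp
    · simp only [ContinuousMap.coe_mk, ContinuousMap.const_apply, hγ]
      rw [hft _ ⟨le_rfl, by simpa using ht.1, by simpa using ht.2⟩, coe_slit_eq_zero (.inl h1)]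
      simp

/-- The winding number of the sum of the elements. -/
theorem exists_winding_sum (s : ℝ) (j : C(X, ExpTwoCircle)) :
    ∃ W : (cpx F X).X 1 →ₗ[F] F, (∀ z ∈ Boundaries F X, W z = 0) ∧
      (∀ c : C(ℝ, X), (∀ t, j (c t) = proj (s + t, s + t)) → W (seg F c 0 1) = 2) ∧
      (∀ c : C(ℝ, X), (∀ t, j (c t) = proj (s, s + t)) → W (seg F c 0 1) = 1) := by
  obtain ⟨W, hW, hWc⟩ := exists_winding F (sum.comp j)
  refine ⟨W, hW, fun γ hγ => ?_, fun γ hγ => ?_⟩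
  · rw [hWc γ ⟨fun t => (s + t) + (s + t), by fun_prop⟩ fun t _ => ?_]
    · have : (s + 1 + (s + 1) : ℝ) = (s + 0) + (s + 0) + (2 : ℤ) := by push_cast; ring
      simp only [ContinuousMap.coe_mk]
      rw [this, Int.floor_add_intCast]
      simp
    · simp only [ContinuousMap.coe_mk, ContinuousMap.comp_apply, hγ]
      rfl
  · rw [hWc γ ⟨fun t => s + (s + t), by fun_prop⟩ fun t _ => ?_]
    · have : (s + (s + 1) : ℝ) = s + (s + 0) + (1 : ℤ) := by push_cast; ring
      simp only [ContinuousMap.coe_mk]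
      rw [this, Int.floor_add_intCast]
      simp
    · simp only [ContinuousMap.coe_mk, ContinuousMap.comp_apply, hγ]
      rfl

theorem proj_add_one_right (x y : ℝ) : proj (x, y + 1) = proj (x, y) := by
  simp [proj]

theorem proj_add_one_left (x y : ℝ) : proj (x + 1, y) = proj (x, y) := by
  simp [proj]

theorem proj_swap (x y : ℝ) : proj (x, y) = proj (y, x) := Sym2.eq_swap

/-- The boundary circle is homologous to twice the core circle. -/
theorem two_smul_seg_sub_seg_mem_boundaries (s : ℝ) (i : C(ExpTwoCircle, X)) (c d : C(ℝ, X))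
    (hc : ∀ t, c t = i (proj (s, s + t))) (hd : ∀ t, d t = i (proj (s + t, s + t))) :
    (2 : F) • seg F c 0 1 - seg F d 0 1 ∈ Boundaries F X := by
  -- Both short sides project to the fiber curve, the second one after a period shift and the swap;
  -- the hypotenuse projects to the boundary curve.
  have h := seg_triangle F (i.comp ⟨proj, continuous_proj⟩) (s, s) (s, s + 1) (s + 1, s + 1)
  have e1 : seg F (i.comp ⟨proj, continuous_proj⟩) (s, s) (s, s + 1) = seg F c 0 1 := by
    refine seg_congr F fun t _ => ?_
    simp only [ContinuousMap.comp_apply, ContinuousMap.coe_mk, hc, Prod.smul_mk, Prod.mk_add_mk,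
      smul_eq_mul]
    ring_nf
  have e2 : seg F (i.comp ⟨proj, continuous_proj⟩) (s, s + 1) (s + 1, s + 1) = seg F c 0 1 := by
    refine seg_congr F fun t _ => ?_
    simp only [ContinuousMap.comp_apply, ContinuousMap.coe_mk, hc, Prod.smul_mk, Prod.mk_add_mk,
      smul_eq_mul]
    rw [show (1 - t) * (s + 1) + t * (s + 1) = s + 1 by ring, proj_add_one_right, proj_swap]
    ring_nf
  have e3 : seg F (i.comp ⟨proj, continuous_proj⟩) (s, s) (s + 1, s + 1) = seg F d 0 1 := by
    refine seg_congr F fun t _ => ?_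
    simp only [ContinuousMap.comp_apply, ContinuousMap.coe_mk, hd, Prod.smul_mk, Prod.mk_add_mk,
      smul_eq_mul]
    ring_nf
  rw [e1, e2, e3] at h
  rwa [two_smul]

end ExpTwoCircle

/-! ### Maps homotopic to maps through a circle -/

namespace SingularChain

variable (F : Type) [Field F] {X : Type} [TopologicalSpace X]

/-- A path is homologous to any segment in `ℝ` with the same end points. -/
theorem seg_comp_real (D : C(ℝ, X)) (l : C(ℝ, ℝ)) :
    seg F (D.comp l) 0 1 - seg F D (l 0) (l 1) ∈ Boundaries F X := by
  let κ : C(ℝ × ℝ, X) := D.comp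
    ⟨fun z => (1 - z.2) * l z.1 + z.2 * ((1 - z.1) * l 0 + z.1 * l 1), by fun_prop⟩
  have h := seg_square F κ (0, 0) (1, 0) (0, 1) (1, 1)
  have e1 : seg F κ (0, 0) (1, 0) = seg F (D.comp l) 0 1 := by
    refine seg_congr F fun t _ => ?_
    simp [κ]
  have e2 : seg F κ (1, 0) (1, 1) ∈ Boundaries F X := by
    refine seg_const F (D (l 1)) _ _ _ fun t _ => ?_
    simp [κ, ← add_mul]
  have e3 : seg F κ (0, 0) (0, 1) ∈ Boundaries F X := by
    refine seg_const F (D (l 0)) _ _ _ fun t _ => ?_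
    simp [κ, ← add_mul]
  have e4 : seg F κ (0, 1) (1, 1) = seg F D (l 0) (l 1) := by
    refine seg_congr F fun t _ => ?_
    simp [κ]
  rw [e1, e4] at h
  have := Submodule.add_mem _ (Submodule.sub_mem _ h e2) e3
  convert this using 1
  abel

/-- A map which is homotopic to a map through a circle on which the circle becomes null-homologous
induces zero on the first homology. -/
theorem push_mem_boundaries_of_homotopy {Y : Type} [TopologicalSpace Y] (f : C(X, Y))
    (D : C(ℝ, Y)) (hD : ∀ x, D (x + 1) = D x) (hD0 : seg F D 0 1 ∈ Boundaries F Y)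
    (ρ : C(X, UnitAddCircle)) (H : C(unitInterval × X, Y)) (h0 : ∀ x, H (0, x) = f x)
    (h1 : ∀ x (l : ℝ), (l : UnitAddCircle) = ρ x → H (1, x) = D l)
    {z : (cpx F X).X 1} (hz : z ∈ Cycles F X) : push F 1 f z ∈ Boundaries F Y := by
  set π := (Boundaries F Y).mkQ with hπ
  have hmem : ∀ a, a ∈ Boundaries F Y ↔ π a = 0 := fun a => by
    rw [hπ, Submodule.mkQ_apply, Submodule.Quotient.mk_eq_zero]
  -- As a full turn of D is a boundary, the arc of D from 0 to x depends, modulo boundaries, only on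
  -- x modulo 1.
  have hper : Function.Periodic (fun x : ℝ => π (seg F D 0 x)) 1 := by
    intro x
    have e : seg F D 1 (x + 1) = seg F D 0 x := by
      refine seg_congr F fun t _ => ?_
      rw [← hD ((1 - t) • 0 + t • x)]
      congr 1
      simp only [smul_eq_mul]
      ring
    have ht := seg_triangle F D 0 1 (x + 1)
    rw [e, hmem, map_sub, map_add, (hmem _).1 hD0, zero_add, sub_eq_zero] at ht
    exact ht.symm
  let τ : X → C(ℝ, Y) := fun x => H.comp
    ⟨fun t => (Set.projIcc (0 : ℝ) 1 zero_le_one t, x), by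
      have := continuous_projIcc (h := zero_le_one (α := ℝ)); fun_prop⟩
  obtain ⟨rep, hrep⟩ : ∃ rep : UnitAddCircle → ℝ, ∀ x, (rep x : UnitAddCircle) = x :=
    ⟨Quotient.out, fun x => Quotient.out_eq _⟩
  have hrepL : ∀ l : ℝ, π (seg F D 0 (rep l)) = π (seg F D 0 l) := by
    intro l
    have h1 := hper.lift_coe (rep l)
    have h2 := hper.lift_coe l
    rw [hrep] at h1
    exact h1.symm.trans h2
  -- The endpoint term goes along D up to the angle of x, and then back along the track of x under
  -- H.
  refine push_mem_of_forall_seg F f (fun x => seg F D 0 (rep (ρ x)) - seg F (τ x) 0 1) _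
    (fun c => ?_) hz
  obtain ⟨e, he⟩ := QuotientAddGroup.mk_surjective (ρ (c 0))
  obtain ⟨l, ⟨-, hl⟩, -⟩ := (AddCircle.isCoveringMap_coe (1 : ℝ)).existsUnique_continuousMap_lifts
    (ρ.comp c) 0 e he
  have hl' : ∀ t, (l t : UnitAddCircle) = ρ (c t) := fun t => congrFun hl t
  let κ : C(ℝ × ℝ, Y) := H.comp ⟨fun z => (Set.projIcc (0 : ℝ) 1 zero_le_one z.2, c z.1), by
    have := continuous_projIcc (h := zero_le_one (α := ℝ)); fun_prop⟩
  have h := seg_square F κ (0, 0) (1, 0) (0, 1) (1, 1)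
  have e1 : seg F κ (0, 0) (1, 0) = seg F (f.comp c) 0 1 := by
    refine seg_congr F fun t _ => ?_
    simp [κ, h0]
  have e2 : seg F κ (1, 0) (1, 1) = seg F (τ (c 1)) 0 1 := by
    refine seg_congr F fun t _ => ?_
    simp [κ, τ]
  have e3 : seg F κ (0, 0) (0, 1) = seg F (τ (c 0)) 0 1 := by
    refine seg_congr F fun t _ => ?_
    simp [κ, τ]
  have e4 : seg F κ (0, 1) (1, 1) = seg F (D.comp l) 0 1 := by
    refine seg_congr F fun t _ => ?_
    simp [κ, h1 _ _ (hl' t)]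
  rw [e1, e2, e3, e4, hmem] at h
  have h2 := seg_comp_real F D l
  rw [hmem] at h2
  have h3 := seg_triangle F D 0 (l 0) (l 1)
  rw [hmem] at h3
  have h4 : π (seg F D 0 (rep (ρ (c 1)))) = π (seg F D 0 (l 1)) := by rw [← hl', hrepL]
  have h5 : π (seg F D 0 (rep (ρ (c 0)))) = π (seg F D 0 (l 0)) := by rw [← hl', hrepL]
  rw [hmem]
  simp only [map_sub, map_add] at h h2 h3 ⊢
  rw [h4, h5]
  have := congrArg₂ (· + ·) (congrArg₂ (· + ·) h h2) h3
  simp only [add_zero] at this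
  rw [← this]
  abel

end SingularChain

/-! ### Detecting points of the diagram by ranks -/

namespace EReal

theorem exists_Icc_coe_subset {x : ℝ} {A : Set EReal} (hA : A ∈ 𝓝 (x : EReal)) :
    ∃ ε > 0, Set.Icc ((x - ε : ℝ) : EReal) ((x + ε : ℝ) : EReal) ⊆ A := by
  have h := continuous_coe_real_ereal.continuousAt.preimage_mem_nhds hA
  obtain ⟨ε, hε, hball⟩ := Metric.nhds_basis_closedBall.mem_iff.1 h
  refine ⟨ε, hε, fun y hy => ?_⟩
  induction y with
  | bot => exact absurd hy.1 (not_le.2 (EReal.bot_lt_coe _))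
  | top => exact absurd hy.2 (not_le.2 (EReal.coe_lt_top _))
  | coe y =>
    refine hball ?_
    rw [Real.closedBall_eq_Icc]
    exact ⟨EReal.coe_le_coe_iff.1 hy.1, EReal.coe_le_coe_iff.1 hy.2⟩

end EReal

namespace PersistenceModule

variable {F : Type} [Field F] {V : PersistenceModule F}

theorem rank_pos (hV : V.IsQTame) {s t : ℝ} (h : s < t) {x : V.obj s}
    (hx : (V.map (homOfLE h.le)).hom x ≠ 0) : 0 < V.rank s t := by
  have := hV s t h
  rw [rank_coe V h.le]
  have : Nontrivial (LinearMap.range (V.map (homOfLE h.le)).hom) :=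
    ⟨⟨⟨_, x, rfl⟩, 0, fun h0 => hx (congrArg Subtype.val h0)⟩⟩
  exact Module.finrank_pos

theorem rank_eq_zero {s t : ℝ} (h : s ≤ t) (hx : ∀ x, (V.map (homOfLE h)).hom x = 0) :
    V.rank s t = 0 := by
  rw [rank_coe V h, LinearMap.range_eq_bot.2 (LinearMap.ext hx), finrank_bot]

theorem map_map (V : PersistenceModule F) {r s t : ℝ} (h : r ≤ s) (h' : s ≤ t) (x : V.obj r) :
    (V.map (homOfLE h')).hom ((V.map (homOfLE h)).hom x) =
      (V.map (homOfLE (h.trans h'))).hom x := by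
  rw [map_comp_hom V h h']; rfl

/-- Criterion for a point with finite coordinates to be in the diagram. -/
theorem IsDiagram.ne_zero_of_finite {D : EReal × EReal → ℕ} (hD : V.IsDiagram D) {x y : ℝ}
    (hxy : x < y) (h : ∀ ε > 0, ∃ a b c d : ℝ, a < b ∧ b < c ∧ c < d ∧ x - ε ≤ a ∧ b ≤ x + ε ∧
      y - ε ≤ c ∧ d ≤ y + ε ∧ 0 < V.measure a b c d) : D (x, y) ≠ 0 := by
  refine hD.ne_zero_of_forall_nhds (EReal.coe_lt_coe_iff.2 hxy) fun U hU => ?_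
  rw [nhds_prod_eq, Filter.mem_prod_iff] at hU
  obtain ⟨A, hA, B, hB, hAB⟩ := hU
  obtain ⟨ε, hε, hεA⟩ := EReal.exists_Icc_coe_subset hA
  obtain ⟨δ, hδ, hδB⟩ := EReal.exists_Icc_coe_subset hB
  obtain ⟨a, b, c, d, hab, hbc, hcd, h1, h2, h3, h4, h5⟩ := h (min ε δ) (lt_min hε hδ)
  refine ⟨a, b, c, d, EReal.coe_lt_coe_iff.2 hab, EReal.coe_lt_coe_iff.2 hbc,
    EReal.coe_lt_coe_iff.2 hcd, (Set.prod_mono ?_ ?_).trans hAB, h5⟩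
  · refine (Set.Icc_subset_Icc ?_ ?_).trans hεA
    · exact EReal.coe_le_coe_iff.2 (by linarith [min_le_left ε δ])
    · exact EReal.coe_le_coe_iff.2 (by linarith [min_le_left ε δ])
  · refine (Set.Icc_subset_Icc ?_ ?_).trans hδB
    · exact EReal.coe_le_coe_iff.2 (by linarith [min_le_right ε δ])
    · exact EReal.coe_le_coe_iff.2 (by linarith [min_le_right ε δ])

/-- Criterion for a point at infinity to be in the diagram: the rank jumps at `x`. -/
theorem IsDiagram.ne_zero_of_top {D : EReal × EReal → ℕ} (hD : V.IsDiagram D) {x : ℝ} (m : ℝ)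
    (h0 : ∀ a c : ℝ, a < x → a ≤ c → m ≤ c → V.rank a c = 0)
    (h1 : ∀ b c : ℝ, x < b → b < c → m ≤ c → 0 < V.rank b c) : D (x, ⊤) ≠ 0 := by
  refine hD.ne_zero_of_forall_nhds (EReal.coe_lt_top x) fun U hU => ?_
  rw [nhds_prod_eq, Filter.mem_prod_iff] at hU
  obtain ⟨A, hA, B, hB, hAB⟩ := hU
  obtain ⟨ε, hε, hεA⟩ := EReal.exists_Icc_coe_subset hA
  obtain ⟨y, hy⟩ := EReal.mem_nhds_top_iff.1 hB
  obtain ⟨c, hcb, hcm, hcy⟩ : ∃ c : ℝ, x + ε < c ∧ m ≤ c ∧ y < c := by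
    obtain ⟨c, hc⟩ := exists_gt (max (max (x + ε) m) y)
    simp only [max_lt_iff] at hc
    exact ⟨c, hc.1.1, hc.1.2.le, hc.2⟩
  refine ⟨(x - ε : ℝ), (x + ε : ℝ), c, ⊤, EReal.coe_lt_coe_iff.2 (by linarith),
    EReal.coe_lt_coe_iff.2 hcb, EReal.coe_lt_top c, (Set.prod_mono hεA ?_).trans hAB, ?_⟩
  · exact fun z hz => hy ((EReal.coe_lt_coe_iff.2 hcy).trans_le hz.1)
  · have h2 := h0 (x - ε) c (by linarith) (by linarith) hcm
    have h3 := h1 (x + ε) c (by linarith) hcb hcm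
    simp only [measure, rank_top, h2]
    omega

end PersistenceModule

/-! ### Curves in sublevel sets and the classes they carry -/

namespace ExpTwoCircle

variable (F : Type) [Field F] {g : ExpTwoCircle → ℝ}

/-- A curve in a sublevel set. -/
def sublevelCurve {b : ℝ} (j : C(ℝ, ExpTwoCircle)) (h : ∀ t, g (j t) ≤ b) :
    C(ℝ, {w // g w ≤ b}) := ⟨fun t => ⟨j t, h t⟩, by fun_prop⟩

/-- The boundary curve. -/
def diagCurve (s : ℝ) : C(ℝ, ExpTwoCircle) :=
  ⟨fun t => proj (s + t, s + t), by have := continuous_proj; fun_prop⟩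

/-- The curve of all subsets which contain a given point. -/
def fiberCurve (s : ℝ) : C(ℝ, ExpTwoCircle) :=
  ⟨fun t => proj (s, s + t), by have := continuous_proj; fun_prop⟩

theorem seg_mem_cycles {X : Type} [TopologicalSpace X] (c : C(ℝ, X)) (h : c 1 = c 0) :
    seg F c 0 1 ∈ Cycles F X := by
  rw [LinearMap.mem_ker, d_seg, h, sub_self]

theorem seg_sublevelCurve_diagCurve_mem_cycles {b : ℝ} (s : ℝ) (h : ∀ t, g (diagCurve s t) ≤ b) :
    seg F (sublevelCurve (diagCurve s) h) 0 1 ∈ Cycles F {w // g w ≤ b} :=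
  seg_mem_cycles F _ (Subtype.ext (by
    change proj (s + 1, s + 1) = proj (s + 0, s + 0)
    rw [proj_add_one_left, proj_add_one_right, add_zero]))

theorem seg_sublevelCurve_fiberCurve_mem_cycles {b : ℝ} (s : ℝ)
    (h : ∀ t, g (fiberCurve s t) ≤ b) :
    seg F (sublevelCurve (fiberCurve s) h) 0 1 ∈ Cycles F {w // g w ≤ b} :=
  seg_mem_cycles F _ (Subtype.ext (by
    change proj (s, s + 1) = proj (s, s + 0)
    rw [proj_add_one_right, add_zero]))

/-- The inclusion of a sublevel set into the Möbius band. -/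
def sublevelVal (g : ExpTwoCircle → ℝ) (b : ℝ) : C({w // g w ≤ b}, ExpTwoCircle) :=
  ⟨Subtype.val, continuous_subtype_val⟩

theorem eq_zero_of_sublevel_empty {b : ℝ} (h : ∀ w, b < g w)
    (x : (sublevelHomology F 1 g).obj b) : x = 0 := by
  obtain ⟨z, rfl⟩ := cls_surjective F (X := {w // g w ≤ b}) x
  have hz : z.1 ∈ (⊥ : Submodule F ((cpx F {w // g w ≤ b}).X 1)) :=
    mem_of_forall_seg_mem F _ _ fun c => absurd (c 0).2 (not_le.2 (h _))
  have : z = 0 := Subtype.ext ((Submodule.mem_bot F).1 hz)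
  rw [this]
  exact map_zero (cls F)

open AlgebraicTopology in
-- From the maximum on, all sublevel sets are the whole band, so the inclusion has a continuous left
-- inverse.
theorem sublevelHomology_map_injective {c d : ℝ} (hc : ∀ w, g w ≤ c) (h : c ≤ d) :
    Function.Injective ((sublevelHomology F 1 g).map (homOfLE h)).hom := by
  let r : TopCat.of {w // g w ≤ d} ⟶ TopCat.of {w // g w ≤ c} :=
    TopCat.ofHom ⟨fun w => ⟨w.1, hc _⟩, by fun_prop⟩
  have hr : TopCat.ofHom (sublevelIncl g h) ≫ r = 𝟙 _ := rfl
  let G := (singularHomologyFunctor (ModuleCat.{0} F) 1).obj (ModuleCat.of F F)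
  refine Function.LeftInverse.injective (g := (G.map r).hom) fun x => ?_
  have := ((G.map_comp (TopCat.ofHom (sublevelIncl g h)) r).symm.trans
    (congrArg G.map hr)).trans (G.map_id _)
  exact congrArg (fun φ => ModuleCat.Hom.hom φ x) this

theorem sublevelHomology_map_ne_zero {b c : ℝ} (h : b ≤ c) (z : Cycles F {w // g w ≤ b})
    {W : (cpx F {w // g w ≤ c}).X 1 →ₗ[F] F} (hW : ∀ z ∈ Boundaries F {w // g w ≤ c}, W z = 0)
    (hz : W (push F 1 (sublevelIncl g h) z) ≠ 0) :
    ((sublevelHomology F 1 g).map (homOfLE h)).hom (cls F z) ≠ 0 := fun h0 =>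
  hz (hW _ ((sublevelHomology_map_cls_eq_zero_iff F g h z).1 h0))

/-- The boundary curve is not null-homologous in the complement of an interior point. -/
theorem exists_boundary_class {b c : ℝ} (h : b ≤ c) (hb : ∀ w ∈ boundary, g w ≤ b)
    {w₀ : ExpTwoCircle} (hw₀ : w₀ ∉ boundary) (hc : c < g w₀) :
    ∃ x, ((sublevelHomology F 1 g).map (homOfLE h)).hom x ≠ 0 := by
  obtain ⟨⟨x, y⟩, rfl⟩ := isOpenQuotientMap_proj.surjective w₀
  -- The points x + 1/3 and x + 2/3 differ from x and from each other, so they cannot both equal y.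
  obtain ⟨s, hsx, hsy⟩ : ∃ s : ℝ, (s : UnitAddCircle) ≠ x ∧ (s : UnitAddCircle) ≠ y := by
    by_contra! hcon
    have key : ∀ r : ℝ, (r : UnitAddCircle) = 0 → ¬ (0 < r ∧ r < 1) := by
      rintro r hr ⟨h0, h1⟩
      obtain ⟨n, hn⟩ := AddCircle.coe_eq_zero_iff (1 : ℝ) |>.1 hr
      simp only [zsmul_eq_mul, mul_one] at hn
      rw [← hn] at h0 h1
      have h0' : (0 : ℤ) < n := by exact_mod_cast h0
      have h1' : n < (1 : ℤ) := by exact_mod_cast h1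
      omega
    have hd : ∀ r t : ℝ, (r : UnitAddCircle) = t → ((r - t : ℝ) : UnitAddCircle) = 0 := by
      intro r t h
      rw [AddCircle.coe_sub, h, sub_self]
    have h1 : ((x + 1 / 3 : ℝ) : UnitAddCircle) = y := hcon _ fun h =>
      key _ (hd _ _ h) ⟨by linarith, by linarith⟩
    have h2 : ((x + 2 / 3 : ℝ) : UnitAddCircle) = y := hcon _ fun h =>
      key _ (hd _ _ h) ⟨by linarith, by linarith⟩
    exact key _ (hd _ _ (h2.trans h1.symm)) ⟨by linarith, by linarith⟩
  have hs : ∀ t : ℝ, proj (s, t) ≠ proj (x, y) := fun t ht => by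
    rcases Sym2.eq_iff.1 ht with ⟨h, -⟩ | ⟨h, -⟩
    · exact hsx h
    · exact hsy h
  have hle : ∀ t, g (diagCurve s t) ≤ b := fun t => hb _ (Sym2.mk_isDiag_iff.2 rfl)
  obtain ⟨W, hW, hW1, -⟩ := exists_winding_slit F hw₀ hs (sublevelVal g c)
    fun w hw => (hw ▸ w.2 : g (proj (x, y)) ≤ c).not_gt hc
  refine ⟨cls F ⟨_, seg_sublevelCurve_diagCurve_mem_cycles F s hle⟩,
    sublevelHomology_map_ne_zero F h _ hW ?_⟩
  rw [push_seg, hW1 _ fun t => rfl]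
  exact one_ne_zero

/-- In characteristic two, the boundary is null-homologous in the Möbius band. -/
theorem sublevelHomology_map_eq_zero_of_isDeformationRetract (h2 : (2 : F) = 0) {b d : ℝ}
    (hret : IsDeformationRetract boundary {w | g w ≤ b}) (hd : ∀ w, g w ≤ d) (h : b ≤ d)
    (x : (sublevelHomology F 1 g).obj b) :
    ((sublevelHomology F 1 g).map (homOfLE h)).hom x = 0 := by
  obtain ⟨z, rfl⟩ := cls_surjective F (X := {w // g w ≤ b}) x
  obtain ⟨-, H, hH, H0, H1, -⟩ := hret
  refine (sublevelHomology_map_cls_eq_zero_iff F g h z).2 ?_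
  let i : C(ExpTwoCircle, {w // g w ≤ d}) := ⟨fun w => ⟨w, hd w⟩, by fun_prop⟩
  have hδc : Continuous fun θ : UnitAddCircle => (s(θ, θ) : ExpTwoCircle) :=
    isOpenQuotientMap_mk.continuous.comp (continuous_id.prodMk continuous_id)
  -- The circle embeds as the boundary, so the end of the retraction becomes a continuous
  -- circle-valued map ρ.
  have hδ : IsClosedEmbedding fun θ : UnitAddCircle => (s(θ, θ) : ExpTwoCircle) := by
    refine hδc.isClosedEmbedding fun a b hab => ?_
    rcases Sym2.eq_iff.1 hab with ⟨h, -⟩ | ⟨h, -⟩ <;> exact h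
  have hex : ∀ x : {w // g w ≤ b}, ∃ θ : UnitAddCircle, s(θ, θ) = (H (1, x)).1 := fun x => by
    have := H1 x
    obtain ⟨⟨a, a'⟩, ha⟩ := isOpenQuotientMap_mk.surjective (H (1, x)).1
    rw [← ha] at this ⊢
    obtain rfl : a = a' := Sym2.mk_isDiag_iff.1 this
    exact ⟨a, rfl⟩
  choose ρ hρ using hex
  have hρc : Continuous ρ := by
    rw [hδ.isInducing.continuous_iff]
    have : (fun θ : UnitAddCircle => (s(θ, θ) : ExpTwoCircle)) ∘ ρ = fun x => (H (1, x)).1 :=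
      funext hρ
    rw [this]
    exact continuous_subtype_val.comp (hH.comp (continuous_const.prodMk continuous_id))
  refine push_mem_boundaries_of_homotopy F (sublevelIncl g h) (i.comp (diagCurve 0)) ?_ ?_
    ⟨ρ, hρc⟩ ⟨fun y => i (H y).1, i.continuous.comp (continuous_subtype_val.comp hH)⟩ ?_ ?_ z.2
  · intro x
    apply congrArg i
    change proj (0 + (x + 1), 0 + (x + 1)) = proj (0 + x, 0 + x)
    rw [← add_assoc, proj_add_one_left, proj_add_one_right]
  -- With 2 = 0, the relation between boundary and core says that the boundary curve bounds in the
  -- band.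
  · have := two_smul_seg_sub_seg_mem_boundaries F 0 i (i.comp (fiberCurve 0))
      (i.comp (diagCurve 0)) (fun t => rfl) fun t => rfl
    rw [h2, zero_smul, zero_sub] at this
    exact (Submodule.neg_mem_iff _).1 this
  · intro x
    apply Subtype.ext
    change (H (0, x)).1 = x.1
    rw [H0]
  · intro x l hl
    apply congrArg i
    change (H (1, x)).1 = proj (0 + l, 0 + l)
    rw [← hρ, zero_add]
    change _ = s((l : UnitAddCircle), (l : UnitAddCircle))
    rw [hl]
    rfl

/-- The maximum is attained on finitely many subsets, which do not cover the circle. -/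
theorem exists_forall_fiber_lt (hg : Continuous g) {m : ℝ} (hm : ∀ w, g w ≤ m)
    (hfin : {w | g w = m}.Finite) :
    ∃ s : UnitAddCircle, ∃ c < m, ∀ t : UnitAddCircle, g s(s, t) ≤ c := by
  have hf : {s : UnitAddCircle | ∃ w ∈ {w | g w = m}, s ∈ w}.Finite := by
    have : {s : UnitAddCircle | ∃ w ∈ {w | g w = m}, s ∈ w} =
        ⋃ w ∈ {w | g w = m}, {s | s ∈ w} := by ext; simp
    rw [this]
    refine hfin.biUnion fun w _ => ?_
    obtain ⟨⟨a, b⟩, rfl⟩ := isOpenQuotientMap_mk.surjective w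
    refine (Set.toFinite {a, b}).subset fun x hx => ?_
    simpa using hx
  have hinf : Infinite UnitAddCircle := by
    have : Infinite (Set.Ico (0 : ℝ) (0 + 1)) := (Set.Ico_infinite (by norm_num)).to_subtype
    refine Infinite.of_injective (fun x : Set.Ico (0 : ℝ) (0 + 1) => (x.1 : UnitAddCircle))
      fun x y h => Subtype.ext ?_
    exact (AddCircle.coe_eq_coe_iff_of_mem_Ico x.2 y.2).1 h
  -- Choose s outside all the maximal sets; the fiber over s is compact, so its own maximum is
  -- strictly smaller.
  obtain ⟨s, hs⟩ := hf.exists_notMem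
  have hc : Continuous fun t : UnitAddCircle => g s(s, t) :=
    hg.comp (isOpenQuotientMap_mk.continuous.comp (continuous_const.prodMk continuous_id))
  obtain ⟨t, -, ht⟩ := isCompact_univ.exists_isMaxOn Set.univ_nonempty hc.continuousOn
  refine ⟨s, g s(s, t), lt_of_le_of_ne (hm _) fun h => hs ⟨_, h, by simp⟩, fun u => ?_⟩
  exact ht (Set.mem_univ u)

end ExpTwoCircle

/-! ### Morse-supported functions and their diagram points -/

theorem IsMorseSupported.continuous {g : ExpTwoCircle → ℝ} (hg : IsMorseSupported g) :
    Continuous g :=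
  continuous_of_continuousOn_strip hg.contDiff.continuousOn

/-- Since g vanishes on the boundary, points of positive maximal value are interior and hence
critical. -/
theorem IsMorseSupported.finite_max {g : ExpTwoCircle → ℝ} (hg : IsMorseSupported g) {m : ℝ}
    (hm : ∀ w, g w ≤ m) (hpos : 0 < m) : {w | g w = m}.Finite := by
  refine hg.finite_critical.subset fun w hw => ?_
  obtain ⟨z, ⟨h1, h2, h3⟩, rfl⟩ := exists_mem_triangle 0 w
  have hnb : proj z ∉ boundary := fun hb => by
    rw [← hg.zero_iff] at hb
    exact hpos.ne (hb.symm.trans hw)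
  refine ⟨z, ⟨⟨lt_of_le_of_ne h2 fun h => hnb ?_, lt_of_le_of_ne (by linarith) fun h => hnb ?_⟩, ?_⟩,
    rfl⟩
  · change Sym2.IsDiag s(_, _)
    rw [Sym2.mk_isDiag_iff, h]
  · change Sym2.IsDiag s(_, _)
    rw [Sym2.mk_isDiag_iff, h, AddCircle.coe_add_period]
  · apply IsLocalMax.fderiv_eq_zero
    exact Filter.Eventually.of_forall fun z' => (hm _).trans (le_of_eq hw.symm)

namespace IsMorseSupported

variable {g : ExpTwoCircle → ℝ}

theorem eq_zero_of_mem (hg : IsMorseSupported g) {w : ExpTwoCircle} (hw : w ∈ boundary) : g w = 0 := (hg.zero_iff w).2 hw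

theorem bddAbove_range (hg : IsMorseSupported g) : BddAbove (Set.range g) := (isCompact_range hg.continuous).bddAbove

theorem le_iSup (hg : IsMorseSupported g) (w : ExpTwoCircle) : g w ≤ ⨆ w, g w := le_ciSup hg.bddAbove_range w

theorem exists_eq_iSup (hg : IsMorseSupported g) : ∃ w, g w = ⨆ w, g w := by
  obtain ⟨w, -, hw⟩ := isCompact_univ.exists_isMaxOn (s := (Set.univ : Set ExpTwoCircle))
    ⟨proj (0, 0), Set.mem_univ _⟩ hg.continuous.continuousOn
  have : Nonempty ExpTwoCircle := ⟨w⟩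
  exact ⟨w, le_antisymm (hg.le_iSup w) (ciSup_le fun v => hw (Set.mem_univ v))⟩

theorem iSup_pos (hg : IsMorseSupported g) : 0 < ⨆ w, g w := by
  have h : proj (0, 1 / 2) ∉ boundary := by
    intro h
    have h1 : ((0 : ℝ) : UnitAddCircle) = ((1 / 2 : ℝ) : UnitAddCircle) := Sym2.mk_isDiag_iff.1 h
    rw [coe_eq_coe_iff_of_mem_Icc (s := 0) (by norm_num) (by norm_num)] at h1
    norm_num at h1
  refine lt_of_lt_of_le ?_ (hg.le_iSup (proj (0, 1 / 2)))
  exact lt_of_le_of_ne (hg.nonneg _) fun h0 => h ((hg.zero_iff _).1 h0.symm)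

theorem le_fiber (hg : IsMorseSupported g) (s t : UnitAddCircle) :
    g s(s, t) ≤ ⨆ t : UnitAddCircle, g s(s, t) :=
  le_ciSup (f := fun t : UnitAddCircle => g s(s, t))
    (hg.bddAbove_range.mono (Set.range_subset_iff.2 fun _ => Set.mem_range_self _)) t

theorem diagCurve_le (hg : IsMorseSupported g) {b : ℝ} (hb : 0 ≤ b) (s t : ℝ) :
    g (diagCurve s t) ≤ b :=
  (hg.eq_zero_of_mem (Sym2.mk_isDiag_iff.2 rfl)).le.trans hb

variable (F : Type) [Field F]

theorem eq_zero_of_neg (hg : IsMorseSupported g) {b : ℝ} (hb : b < 0) (x : (sublevelHomology F 1 g).obj b) : x = 0 :=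
  eq_zero_of_sublevel_empty F (fun w => hb.trans_le (hg.nonneg w)) x

theorem rank_eq_zero_of_neg (hg : IsMorseSupported g) {a c : ℝ} (ha : a < 0) (h : a ≤ c) :
    (sublevelHomology F 1 g).rank a c = 0 :=
  PersistenceModule.rank_eq_zero h fun x => by rw [hg.eq_zero_of_neg F ha x, map_zero]

/-- In characteristic two, the boundary class is born at `0` and dies at the maximum. -/
theorem diagram_zero_iSup_ne_zero (hg : IsMorseSupported g) (h2 : (2 : F) = 0) :
    (sublevelHomology F 1 g).diagram ((0 : ℝ), (⨆ w, g w : ℝ)) ≠ 0 := by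
  have hV := isQTame_sublevelHomology F hg.continuous
  set V := sublevelHomology F 1 g
  obtain ⟨a₀, ha₀, hret⟩ := hg.retract
  have hpos := hg.iSup_pos
  obtain ⟨w₀, hw₀⟩ := hg.exists_eq_iSup
  have hle := hg.le_iSup
  generalize (⨆ w, g w) = m at *
  refine hV.isDiagram_diagram.ne_zero_of_finite hpos fun ε hε => ?_
  -- The bound by a₀ makes the sublevel set at b deform onto the boundary, so the rank from b to m +
  -- ε vanishes.
  obtain ⟨b, hb0, hb⟩ := exists_between (lt_min (lt_min hε ha₀) hpos)
  simp only [lt_min_iff] at hb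
  obtain ⟨c, hc, hcm⟩ := exists_between (max_lt hb.2 (sub_lt_self m hε))
  simp only [max_lt_iff] at hc
  refine ⟨-ε, b, c, m + ε, by linarith, hc.1, by linarith, by linarith, by linarith [hb.1.1],
    hc.2.le, le_rfl, ?_⟩
  have r1 : V.rank ((-ε : ℝ) : EReal) c = 0 := hg.rank_eq_zero_of_neg F (by linarith) (by linarith)
  have r2 : V.rank (b : EReal) ((m + ε : ℝ) : EReal) = 0 :=
    PersistenceModule.rank_eq_zero (by linarith) fun x =>
      sublevelHomology_map_eq_zero_of_isDeformationRetract F h2 (hret b ⟨hb0.le, hb.1.2.le⟩)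
        (fun w => (hle w).trans (by linarith)) (by linarith) x
  obtain ⟨x, hx⟩ := exists_boundary_class F hc.1.le
    (fun w hw => (hg.eq_zero_of_mem hw).le.trans hb0.le) (fun hw => by
      rw [hg.eq_zero_of_mem hw] at hw₀; exact hpos.ne hw₀) (hcm.trans_eq hw₀.symm)
  have r3 := PersistenceModule.rank_pos hV hc.1 hx
  simp only [PersistenceModule.measure, r1, r2]
  omega

/-- In odd characteristic, the boundary class is born at `0` and does not die. -/
theorem diagram_zero_top_ne_zero (hg : IsMorseSupported g) (h2 : (2 : F) ≠ 0) :
    (sublevelHomology F 1 g).diagram ((0 : ℝ), ⊤) ≠ 0 := by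
  have hV := isQTame_sublevelHomology F hg.continuous
  refine hV.isDiagram_diagram.ne_zero_of_top 0
    (fun a c ha hac _ => hg.rank_eq_zero_of_neg F ha hac) fun b c hb hbc _ => ?_
  obtain ⟨W, hW, hW2, -⟩ := exists_winding_sum F 0 (sublevelVal g c)
  refine PersistenceModule.rank_pos hV hbc (x := cls F
    ⟨_, seg_sublevelCurve_diagCurve_mem_cycles F 0 (hg.diagCurve_le hb.le 0)⟩)
    (sublevelHomology_map_ne_zero F hbc.le _ hW ?_)
  rw [push_seg, hW2 _ fun t => rfl]
  exact h2

/-- The core class does not die, and is born before the min-max value. -/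
theorem exists_diagram_top_ne_zero (hg : IsMorseSupported g) : ∃ l : ℝ,
    l ≤ (⨅ s : UnitAddCircle, ⨆ t : UnitAddCircle, g s(s, t)) ∧
      (sublevelHomology F 1 g).diagram (l, ⊤) ≠ 0 := by
  have hV := isQTame_sublevelHomology F hg.continuous
  set V := sublevelHomology F 1 g
  have hle := hg.le_iSup
  have hfib : ∀ s : UnitAddCircle, (⨆ t : UnitAddCircle, g s(s, t)) ≤ ⨆ w, g w :=
    fun s => ciSup_le fun t => hle _
  generalize (⨆ w, g w) = m at *
  -- Levels carrying a class that survives to the maximum, and hence forever, since the maps beyond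
  -- m are injective.
  let S : Set ℝ := {b | ∃ (h : b ≤ m) (x : V.obj b), (V.map (homOfLE h)).hom x ≠ 0}
  have hS : ∀ s : UnitAddCircle, (⨆ t : UnitAddCircle, g s(s, t)) ∈ S := by
    intro s
    obtain ⟨s, rfl⟩ := QuotientAddGroup.mk_surjective s
    refine ⟨hfib _, ?_⟩
    obtain ⟨W, hW, -, hW1⟩ := exists_winding_sum F s (sublevelVal g m)
    refine ⟨cls F ⟨_, seg_sublevelCurve_fiberCurve_mem_cycles F s fun t => hg.le_fiber _ _⟩,
      sublevelHomology_map_ne_zero F (hfib _) _ hW ?_⟩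
    rw [push_seg, hW1 _ fun t => rfl]
    exact one_ne_zero
  have hbdd : BddBelow S := ⟨0, fun b ⟨h, x, hx⟩ => by
    by_contra hb
    rw [hg.eq_zero_of_neg F (not_le.1 hb) x, map_zero] at hx
    exact hx rfl⟩
  refine ⟨sInf S, le_ciInf fun s => csInf_le hbdd (hS s),
    hV.isDiagram_diagram.ne_zero_of_top m (fun a c ha hac hmc => ?_) fun b c hb hbc hmc => ?_⟩
  · have ham : a ≤ m := ha.le.trans ((csInf_le hbdd (hS 0)).trans (hfib 0))
    refine PersistenceModule.rank_eq_zero hac fun x => ?_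
    have h0 : (V.map (homOfLE ham)).hom x = 0 := by
      by_contra hx
      exact (csInf_le hbdd ⟨ham, x, hx⟩).not_gt ha
    rw [← PersistenceModule.map_map V ham hmc, h0, map_zero]
  · obtain ⟨b', ⟨hb'm, x, hx⟩, hb'⟩ := exists_lt_of_csInf_lt ⟨_, hS 0⟩ hb
    refine PersistenceModule.rank_pos hV hbc (x := (V.map (homOfLE hb'.le)).hom x) ?_
    rw [PersistenceModule.map_map V, ← PersistenceModule.map_map V hb'm hmc]
    exact fun h0 => hx (sublevelHomology_map_injective F hle hmc (h0.trans (map_zero _).symm))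

/-- In odd characteristic, the difference of the boundary class and twice the core class is born
before the min-max value and dies at the maximum. -/
theorem exists_diagram_iSup_ne_zero (hg : IsMorseSupported g) : ∃ l : ℝ,
    l ≤ (⨅ s : UnitAddCircle, ⨆ t : UnitAddCircle, g s(s, t)) ∧
      (sublevelHomology F 1 g).diagram (l, (⨆ w, g w : ℝ)) ≠ 0 := by
  have hV := isQTame_sublevelHomology F hg.continuous
  set V := sublevelHomology F 1 g
  have hle := hg.le_iSup
  have hpos := hg.iSup_pos
  obtain ⟨w₀, hw₀⟩ := hg.exists_eq_iSup
  generalize (⨆ w, g w) = m at *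
  -- The class may depend on c. If b < m is not in S, there is thus one level c₁ < m at which all
  -- classes from b that die at m are already dead.
  let S : Set ℝ := {b | ∃ hb : b < m, ∀ (c : ℝ) (hc : b ≤ c), c < m → ∃ x : V.obj b,
    (V.map (homOfLE hc)).hom x ≠ 0 ∧ (V.map (homOfLE hb.le)).hom x = 0}
  have hS : ∀ s : UnitAddCircle, (⨆ t : UnitAddCircle, g s(s, t)) < m →
      (⨆ t : UnitAddCircle, g s(s, t)) ∈ S := by
    intro s hs
    obtain ⟨s, rfl⟩ := QuotientAddGroup.mk_surjective s
    have hfib : ∀ t, g (fiberCurve s t) ≤ ⨆ t : UnitAddCircle, g s(s, t) :=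
      fun t => hg.le_fiber _ _
    have hdiag := hg.diagCurve_le ((hg.nonneg _).trans (hfib 0)) s
    refine ⟨hs, fun c hc hcm => ?_⟩
    obtain ⟨W, hW, hW1, hW0⟩ := exists_winding_slit F (w₀ := w₀) (s := s) (fun hw => by
        rw [hg.eq_zero_of_mem hw] at hw₀; exact hpos.ne hw₀) (fun t ht => by
        have : g s((s : UnitAddCircle), (t : UnitAddCircle)) = m := (congrArg g ht).trans hw₀
        exact (this ▸ hg.le_fiber (s : UnitAddCircle) t).not_gt hs) (sublevelVal g c)
        fun w hw => (hw ▸ w.2 : g w₀ ≤ c).not_gt (hcm.trans_eq hw₀.symm)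
    refine ⟨cls F ((2 : F) • ⟨_, seg_sublevelCurve_fiberCurve_mem_cycles F s hfib⟩ -
      ⟨_, seg_sublevelCurve_diagCurve_mem_cycles F s hdiag⟩),
      sublevelHomology_map_ne_zero F hc _ hW ?_,
      (sublevelHomology_map_cls_eq_zero_iff F g hs.le _).2 ?_⟩
    · simp only [Submodule.coe_sub, Submodule.coe_smul, map_sub, map_smul, push_seg]
      rw [hW0 _ fun t => rfl, hW1 _ fun t => rfl]
      simp
    · simp only [Submodule.coe_sub, Submodule.coe_smul, map_sub, map_smul, push_seg]
      exact two_smul_seg_sub_seg_mem_boundaries F s ⟨fun w => ⟨w, hle w⟩, by fun_prop⟩ _ _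
        (fun t => rfl) fun t => rfl
  obtain ⟨s₀, c₀, hc₀, hs₀⟩ := exists_forall_fiber_lt hg.continuous hle (hg.finite_max hle hpos)
  have hs₀m : (⨆ t : UnitAddCircle, g s(s₀, t)) < m := (ciSup_le hs₀).trans_lt hc₀
  have hbdd : BddBelow S := ⟨0, fun b ⟨h, hx⟩ => by
    by_contra hb
    obtain ⟨x, hx, -⟩ := hx b le_rfl h
    rw [hg.eq_zero_of_neg F (not_le.1 hb) x, map_zero] at hx
    exact hx rfl⟩
  have hlm : sInf S < m := (csInf_le hbdd (hS s₀ hs₀m)).trans_lt hs₀m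
  refine ⟨sInf S, le_ciInf fun s => ?_, hV.isDiagram_diagram.ne_zero_of_finite hlm fun ε hε => ?_⟩
  -- A fiber through a maximum point need not give an element of S, but its bound follows from
  -- `hlm`.
  · rcases lt_or_ge (⨆ t : UnitAddCircle, g s(s, t)) m with h | h
    · exact csInf_le hbdd (hS s h)
    · exact hlm.le.trans h
  obtain ⟨b, hlb, hb⟩ := exists_between (lt_min (lt_add_of_pos_right (sInf S) hε) hlm)
  rw [lt_min_iff] at hb
  have ham : sInf S - ε < m := by linarith
  have haS : sInf S - ε ∉ S := fun h => (csInf_le hbdd h).not_gt (by linarith)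
  obtain ⟨c₁, hac₁, hc₁m, hc₁⟩ : ∃ (c : ℝ) (hc : sInf S - ε ≤ c), c < m ∧
      ∀ x : V.obj (sInf S - ε), (V.map (homOfLE ham.le)).hom x = 0 →
        (V.map (homOfLE hc)).hom x = 0 := by
    by_contra! hcon
    exact haS ⟨ham, fun c hc hcm => by
      obtain ⟨x, h1, h2⟩ := hcon c hc hcm
      exact ⟨x, h2, h1⟩⟩
  -- Beyond c₁, no nonzero class coming from the left edge is killed at m.
  obtain ⟨c, hc, hcm⟩ := exists_between (max_lt (max_lt hb.2 hc₁m) (sub_lt_self m hε))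
  simp only [max_lt_iff] at hc
  have hcd : c ≤ m + ε := by linarith
  refine ⟨sInf S - ε, b, c, m + ε, by linarith, hc.1.1, by linarith, le_rfl, hb.1.le, hc.2.le,
    le_rfl, ?_⟩
  have hac : sInf S - ε < c := by linarith [hc.1.1]
  have hinj := sublevelHomology_map_injective F hle (by linarith : m ≤ m + ε)
  -- The measure becomes the number of dying classes from b minus that from the left edge. The
  -- latter is 0 by the choice of c₁, the former positive because S has an element below b.
  have key : ∀ {e : ℝ} (he : e < c), (V.rank e c : ℤ) = V.rank e ((m + ε : ℝ) : EReal) +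
      Module.finrank F (LinearMap.range (V.map (homOfLE he.le)).hom ⊓
        LinearMap.ker (V.map (homOfLE hcd)).hom : Submodule F (V.obj c)) := by
    intro e he
    have := hV e c he
    rw [PersistenceModule.rank_coe V he.le, PersistenceModule.rank_coe V (he.le.trans hcd),
      PersistenceModule.map_comp_hom V he.le hcd, ← Nat.cast_add,
      LinearMap.finrank_range_eq_add _ (V.map (homOfLE hcd)).hom]
  have k1 := key hac
  have k2 := key hc.1.1
  have e1 : (LinearMap.range (V.map (homOfLE hac.le)).hom ⊓
      LinearMap.ker (V.map (homOfLE hcd)).hom : Submodule F (V.obj c)) = ⊥ := by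
    rw [Submodule.eq_bot_iff]
    rintro _ ⟨⟨x, rfl⟩, hx⟩
    replace hx := LinearMap.mem_ker.1 (SetLike.mem_coe.1 hx)
    rw [PersistenceModule.map_map V,
      ← PersistenceModule.map_map V ham.le (by linarith : m ≤ m + ε)] at hx
    have h0 := hc₁ x (hinj (hx.trans (map_zero _).symm))
    rw [← PersistenceModule.map_map V hac₁ hc.1.2.le, h0, map_zero]
  obtain ⟨b', ⟨hb'm, hb'⟩, hb'b⟩ := exists_lt_of_csInf_lt ⟨_, hS s₀ hs₀m⟩ hlb
  obtain ⟨x, hx, hx0⟩ := hb' c (hb'b.trans hc.1.1).le hcm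
  have e2 : 0 < Module.finrank F (LinearMap.range (V.map (homOfLE hc.1.1.le)).hom ⊓
      LinearMap.ker (V.map (homOfLE hcd)).hom : Submodule F (V.obj c)) := by
    have := hV b c hc.1.1
    have : FiniteDimensional F (LinearMap.range (V.map (homOfLE hc.1.1.le)).hom ⊓
      LinearMap.ker (V.map (homOfLE hcd)).hom : Submodule F (V.obj c)) :=
      Submodule.finiteDimensional_inf_left _ _
    have hmem : (V.map (homOfLE (hb'b.trans hc.1.1).le)).hom x ∈
        (LinearMap.range (V.map (homOfLE hc.1.1.le)).hom ⊓
          LinearMap.ker (V.map (homOfLE hcd)).hom : Submodule F (V.obj c)) := by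
      refine ⟨⟨(V.map (homOfLE hb'b.le)).hom x, PersistenceModule.map_map V _ _ _⟩,
        LinearMap.mem_ker.2 ?_⟩
      rw [PersistenceModule.map_map V,
        ← PersistenceModule.map_map V hb'm.le (by linarith : m ≤ m + ε), hx0, map_zero]
    have : Nontrivial (LinearMap.range (V.map (homOfLE hc.1.1.le)).hom ⊓
      LinearMap.ker (V.map (homOfLE hcd)).hom : Submodule F (V.obj c)) :=
      ⟨⟨⟨_, hmem⟩, 0, fun h0 => hx (congrArg Subtype.val h0)⟩⟩
    exact Module.finrank_pos
  rw [e1, finrank_bot] at k1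
  simp only [PersistenceModule.measure]
  omega

end IsMorseSupported

theorem proposition3p5 (g : ExpTwoCircle → ℝ) (hg : IsMorseSupported g)
    (p : ℕ) [Fact p.Prime] :
    ∃ l : ℝ, l ≤ (⨅ s : UnitAddCircle, ⨆ t : UnitAddCircle, g s(s, t)) ∧
      (p = 2 →
        ((0 : EReal), ((⨆ w, g w : ℝ) : EReal)) ∈ persistencePoints (ZMod p) 1 g ∧
        ((l : EReal), (⊤ : EReal)) ∈ persistencePoints (ZMod p) 1 g) ∧
      (p ≠ 2 →
        ((0 : EReal), (⊤ : EReal)) ∈ persistencePoints (ZMod p) 1 g ∧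
        ((l : EReal), ((⨆ w, g w : ℝ) : EReal)) ∈ persistencePoints (ZMod p) 1 g) := by
  have h2 : (2 : ZMod p) = 0 ↔ p = 2 := by
    rw [show (2 : ZMod p) = ((2 : ℕ) : ZMod p) by norm_num, ZMod.natCast_eq_zero_iff]
    exact Nat.prime_dvd_prime_iff_eq Fact.out Nat.prime_two
  by_cases hp : p = 2
  · obtain ⟨l, hl, h⟩ := hg.exists_diagram_top_ne_zero (ZMod p)
    exact ⟨l, hl, fun _ => ⟨hg.diagram_zero_iSup_ne_zero (ZMod p) (h2.2 hp), h⟩,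
      fun h => absurd hp h⟩
  · obtain ⟨l, hl, h⟩ := hg.exists_diagram_iSup_ne_zero (ZMod p)
    exact ⟨l, hl, fun h => absurd h hp,
      fun _ => ⟨hg.diagram_zero_top_ne_zero (ZMod p) (h2.not.2 hp), h⟩⟩
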